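/- Let $n\in\mathbb N$, let $\varphi:\mathbb R^n\to\mathbb R^n$ be continuous with a stationary point $x^*$, $\varphi(x^*)=0$, and let $(x_t)$, $(y_t)$, $(s_t)$ be given by $$y_t=\varphi(x_{t-1})+\xi_t,\qquad x_t=x_{t-1}-\gamma(s_{t-1})\,y_t\quad(t\ge1),\qquad s_t=\bigl(s_{t-1}+u(-y_t^{T}y_{t-1})\bigr)^+\quad(t\ge2),$$ with random initial data $x_0\in\mathbb R^n$ and $s_0,s_1\ge0$, where $a^+=\max\{a,0\}$. Suppose the following. **B1 (noise).** $x_0,\xi_1,\xi_2,\dots$ are mutually independent; the $\xi_t$ are identically distributed with mean $0$ and finite covariance matrix $S_\xi=E[\xi_t\xi_t^T]$; $(s_0,s_1)$ is independent of $(x_0,\xi_1,\xi_2,\dots)$. There is $\rho>0$ such that $P(\xi_t\in I)>0$ for every nonempty open ball $I$ contained in the ball of radius $\rho$ about $0$. $E|x_0|<\infty$. **B2 (step).** $\gamma:[0,\infty)\to\mathbb R$ is nonincreasing, $\int_0^\infty\gamma(s)\,ds=\infty$ and $\int_0^\infty\gamma^2(s)\,ds<\infty$. **B3 (Lyapunov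 function).** There are a function $V:\mathbb R^n\to[0,\infty)$, differentiable with differentiable gradient, and a symmetric positive definite matrix $M$ (for instance a positive multiple of the identity) such that 1. $V(x^*)=0$; $\nabla^2V(x)\le M$ for all $x$ (as quadratic forms); $\varphi(x)^T\nabla V(x)>0$ for all $x\ne x^*$; 2. for every $0<\gamma^*<\gamma(0)$ and every $z_0\in\mathbb R^n$, the sequence $z_t=z_{t-1}-\gamma^*\varphi(z_{t-1})$, $t\ge1$, converges to $x^*$, and $(V(z_t))_{t\ge0}$ is nonincreasing; 3. there are $R,\beta_0>0$ such that $\varphi(x)^T\nabla V(x)\ge\frac12\gamma(0)\bigl(\varphi(x)^TM\varphi(x)+\mathrm{tr}(S_\xi M)\bigr)+\beta_0$ whenever $|x-x^*|\ge R$. **B4 (sigmoid).** $u:\mathbb R\to\mathbb R$ is nondecreasing with finite limits $u_-$ at $-\infty$ and $u_+>0$ at $+\infty$, and $u(r)>0$ for every $r>0$. With $$E_\omega=E\Bigl[u\Bigl(\inf_{|p|\le\omega,\ |q|\le\omega}\bigl[-(\xi_1+p)^T(\xi_2+q)\bigr]\Bigr)\Bigr],$$ the limit $E_0=\lim_{\omega\to0^+}E_\omega$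 is positive. Then $\lim_{t\to\infty}x_t=x^*$ almost surely. -/

import Mathlib

open MeasureTheory ProbabilityTheory Filter Topology Set

noncomputable section

/-- `ℝⁿ` with its Euclidean norm. -/
abbrev Vec (n : ℕ) : Type := EuclideanSpace ℝ (Fin n)

/-- The algorithm, pointwise in the sample point. `x 0`, `s 0`, `s 1` are the initial data,
`y t` (`t ≥ 1`) are the noisy measurements; `y 0` and `ξ 0` play no role. -/
structure IsKestenProcess {n : ℕ} {Ω : Type*} (φ : Vec n → Vec n) (γ u : ℝ → ℝ)
    (ξ x y : ℕ → Ω → Vec n) (s : ℕ → Ω → ℝ) : Prop where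
  measurement : ∀ t, 1 ≤ t → ∀ ω, y t ω = φ (x (t - 1) ω) + ξ t ω
  estimate : ∀ t, 1 ≤ t → ∀ ω, x t ω = x (t - 1) ω - γ (s (t - 1) ω) • y t ω
  counter : ∀ t, 2 ≤ t → ∀ ω,
    s t ω = max (s (t - 1) ω + u (-(inner ℝ (y t ω) (y (t - 1) ω)))) 0

/-- The family `x₀, ξ₁, ξ₂, …`, indexed by `0, 1, 2, …`. -/
def sourceFamily {n : ℕ} {Ω : Type*} (x₀ : Ω → Vec n) (ξ : ℕ → Ω → Vec n) : ℕ → Ω → Vec n :=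
  fun t => if t = 0 then x₀ else ξ t

/-- Assumptions on the noise and on the random initial data. -/
structure NoiseAssumptions {n : ℕ} {Ω : Type*} [MeasurableSpace Ω] (P : Measure Ω)
    (ξ : ℕ → Ω → Vec n) (x₀ : Ω → Vec n) (s₀ s₁ : Ω → ℝ) : Prop where
  measurable_noise : ∀ t, 1 ≤ t → Measurable (ξ t)
  measurable_x₀ : Measurable x₀
  measurable_s₀ : Measurable s₀
  measurable_s₁ : Measurable s₁
  /-- the step function is defined on `[0, ∞)` only -/
  nonneg_s₀ : ∀ᵐ ω ∂P, 0 ≤ s₀ ω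
  nonneg_s₁ : ∀ᵐ ω ∂P, 0 ≤ s₁ ω
  /-- `x₀, ξ₁, ξ₂, …` are mutually independent -/
  indep : iIndepFun (sourceFamily x₀ ξ) P
  /-- the pair `(s₀, s₁)` is independent of the whole family `x₀, ξ₁, ξ₂, …` -/
  indep_counter : IndepFun (fun ω => (s₀ ω, s₁ ω)) (fun ω t => sourceFamily x₀ ξ t ω) P
  identDistrib : ∀ t, 1 ≤ t → IdentDistrib (ξ t) (ξ 1) P P
  /-- finite second moments, hence a finite covariance matrix -/
  memLp_two : ∀ t, 1 ≤ t → MemLp (ξ t) 2 P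
  mean_zero : ∀ t, 1 ≤ t → ∫ ω, ξ t ω ∂P = 0
  /-- every open ball inside some fixed ball about the origin is charged -/
  charges_balls : ∃ ρ : ℝ, 0 < ρ ∧ ∀ (c : Vec n) (r : ℝ), 0 < r →
    Metric.ball c r ⊆ Metric.ball 0 ρ → ∀ t, 1 ≤ t → 0 < P (ξ t ⁻¹' Metric.ball c r)
  integrable_x₀ : Integrable x₀ P

/-- Assumptions on the step function, of which only the values on `[0, ∞)` matter. -/
structure StepAssumptions (γ : ℝ → ℝ) : Prop where
  antitone : AntitoneOn γ (Ici 0)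
  integral_eq_top : Tendsto (fun T : ℝ => ∫ r in (0 : ℝ)..T, γ r) atTop atTop
  integrable_sq : IntegrableOn (fun r => γ r ^ 2) (Ici 0)

/-- The covariance matrix `E[ζ ζᵀ]` of a centred random vector `ζ`. -/
def covMatrix {n : ℕ} {Ω : Type*} [MeasurableSpace Ω] (P : Measure Ω) (ζ : Ω → Vec n) :
    Matrix (Fin n) (Fin n) ℝ :=
  Matrix.of fun i j => ∫ ω, ζ ω i * ζ ω j ∂P

/-- The quadratic form `vᵀ M v`. -/
def quadForm {n : ℕ} (M : Matrix (Fin n) (Fin n) ℝ) (v : Vec n) : ℝ :=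
  ∑ i, ∑ j, v i * M i j * v j

/-- Assumptions on the vector field `φ`, its stationary point `xs`, and the Lyapunov function
`V` with Hessian bound `M`; `γ₀` is the maximal step and `S` the covariance of the noise.
The Hessian is the derivative of the gradient; `M` may be any positive definite matrix, a
scalar bound `m > 0` on the eigenvalues of the Hessian being the case `M = m • 1`. -/
structure LyapunovAssumptions {n : ℕ} (φ : Vec n → Vec n) (xs : Vec n) (γ₀ : ℝ)
    (S : Matrix (Fin n) (Fin n) ℝ) (V : Vec n → ℝ) (M : Matrix (Fin n) (Fin n) ℝ) : Prop where
  continuous_field : Continuous φ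
  stationary : φ xs = 0
  differentiable : Differentiable ℝ V
  differentiable_gradient : Differentiable ℝ (gradient V)
  nonneg : ∀ x, 0 ≤ V x
  zero : V xs = 0
  posDef : M.PosDef
  hessian_le : ∀ x v, inner ℝ (fderiv ℝ (gradient V) x v) v ≤ quadForm M v
  descent : ∀ x, x ≠ xs → 0 < inner ℝ (φ x) (gradient V x)
  /-- the iteration with a constant step `g` below the maximal one converges, with `V`
  nonincreasing along it -/
  deterministic : ∀ g : ℝ, 0 < g → g < γ₀ → ∀ z₀ : Vec n,
    Tendsto (fun t : ℕ => (fun z => z - g • φ z)^[t] z₀) atTop (𝓝 xs) ∧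
      Antitone (fun t : ℕ => V ((fun z => z - g • φ z)^[t] z₀))
  far_field : ∃ R β₀ : ℝ, 0 < R ∧ 0 < β₀ ∧ ∀ x, R ≤ ‖x - xs‖ →
    1 / 2 * γ₀ * (quadForm M (φ x) + (S * M).trace) + β₀ ≤ inner ℝ (φ x) (gradient V x)

/-- The infimum of `-(a + p)ᵀ (b + q)` over `|p| ≤ w`, `|q| ≤ w`. -/
def worstProduct {n : ℕ} (w : ℝ) (a b : Vec n) : ℝ :=
  ⨅ pq : Metric.closedBall (0 : Vec n) w × Metric.closedBall (0 : Vec n) w,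
    -(inner ℝ (a + (pq.1 : Vec n)) (b + (pq.2 : Vec n)))

/-- Assumptions on the sigmoid `u`; `ζ₁`, `ζ₂` are two independent copies of the noise. -/
structure SigmoidAssumptions {n : ℕ} {Ω : Type*} [MeasurableSpace Ω] (P : Measure Ω)
    (ζ₁ ζ₂ : Ω → Vec n) (u : ℝ → ℝ) : Prop where
  monotone : Monotone u
  limit_top : ∃ uPlus : ℝ, 0 < uPlus ∧ Tendsto u atTop (𝓝 uPlus)
  limit_bot : ∃ uMinus : ℝ, Tendsto u atBot (𝓝 uMinus)
  /-- the counter increases, so the step decreases, after a negative scalar product -/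
  pos_of_pos : ∀ r, 0 < r → 0 < u r
  limit_expectation_pos : ∃ E₀ : ℝ, 0 < E₀ ∧
    Tendsto (fun w : ℝ => ∫ ω, u (worstProduct w (ζ₁ ω) (ζ₂ ω)) ∂P) (𝓝[>] 0) (𝓝 E₀)

end

/-! The Hessian bound shows that a noisy step of length `g` changes the mean of `V` by at most `-gβ`
far from `xs`, and everywhere by at most a nonpositive term plus `C g²` (`exists_drift`). Where the
squared steps are summable, a supermartingale argument therefore makes `V (x t)` converge. The
difficulty is that the steps are random and stay large as long as the counter stays small. The core
of the proof is that the squared steps are almost surely summable.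

Recurrence. The counter gains at most `b` per step, so even the smallest possible steps have a
divergent sum, and the nonnegative `V` cannot keep a negative drift proportional to the step
(`ae_exists_not_drift`). Hence infinitely often either `V` is small, or both the state and the
counter are bounded. In the second case the noise, which charges all small balls near the origin,
lowers `V` step by step with conditional probability bounded below. By a conditional Borel–Cantelli
lemma `V` is then small infinitely often (`ae_frequently_potential_le`).

Raising the counter. Near `xs`, measurements that alternate between neighbourhoods of `a` and `-a`
have negative scalar products and raise the counter to any prescribed level, while their
displacements almost cancel. Such a run has positive probability, so infinitely often the estimate
is near `xs` with a large counter (`ae_frequently_near_and_counter_ge`).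

Escape. From such a state the squared steps are summable with conditional probability at least one
half (`exists_half_le_measure_summable`). While the field is small, the counter corrected by
`counterGain` of the last measurement has positive drift, so its exponential moments decay
geometrically. The expected squared steps then have a small sum, and this in turn keeps `V` below
its threshold with probability at least one half.

By Lévy's zero-one law the squared steps are summable almost surely. Thus `V (x t)` converges, its
limit is zero by recurrence, and coercivity of `V` gives `x t → xs`. -/

section QuadForm

/-! ### Positive definite quadratic forms. -/

variable {n : ℕ} {M : Matrix (Fin n) (Fin n) ℝ}

lemma continuous_quadForm (M : Matrix (Fin n) (Fin n) ℝ) : Continuous (quadForm M) := by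
  unfold quadForm
  fun_prop

lemma quadForm_smul (M : Matrix (Fin n) (Fin n) ℝ) (g : ℝ) (v : Vec n) :
    quadForm M (g • v) = g ^ 2 * quadForm M v := by
  simp only [quadForm, Finset.mul_sum, PiLp.smul_apply, smul_eq_mul]
  exact Finset.sum_congr rfl fun i _ => Finset.sum_congr rfl fun j _ => by ring

lemma quadForm_eq_dotProduct (M : Matrix (Fin n) (Fin n) ℝ) (v : Vec n) :
    quadForm M v = star v.ofLp ⬝ᵥ (M.mulVec v.ofLp) := by
  simp [quadForm, dotProduct, Matrix.mulVec, Finset.mul_sum, mul_assoc]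

lemma quadForm_nonneg (hM : M.PosDef) (v : Vec n) : 0 ≤ quadForm M v := by
  rw [quadForm_eq_dotProduct]
  exact hM.posSemidef.dotProduct_mulVec_nonneg _

lemma quadForm_pos (hM : M.PosDef) {v : Vec n} (hv : v ≠ 0) : 0 < quadForm M v := by
  rw [quadForm_eq_dotProduct]
  exact hM.dotProduct_mulVec_pos (by simpa using hv)

/-- A positive definite form dominates a positive multiple of the squared norm. -/
lemma exists_le_quadForm (hM : M.PosDef) : ∃ m : ℝ, 0 < m ∧ ∀ v, m * ‖v‖ ^ 2 ≤ quadForm M v := by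
  obtain ⟨m, hm, h⟩ := (isCompact_sphere (0 : Vec n) 1).exists_forall_le'
    (continuous_quadForm M).continuousOn (a := 0)
    (fun v hv => quadForm_pos hM (by rintro rfl; simp at hv))
  refine ⟨m, hm, fun v => ?_⟩
  rcases eq_or_ne v 0 with rfl | hv
  · simpa using quadForm_nonneg hM 0
  · have hv' : 0 < ‖v‖ := norm_pos_iff.2 hv
    have h1 := h (‖v‖⁻¹ • v) (by simp [norm_smul, hv'.ne'])
    rw [quadForm_smul, inv_pow, inv_mul_eq_div, le_div_iff₀ (by positivity)] at h1
    exact h1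

end QuadForm

/-! ### Second-order upper bound for the potential. -/

section Taylor

variable {n : ℕ} {V : Vec n → ℝ} {M : Matrix (Fin n) (Fin n) ℝ}

/-- The quadratic upper bound that follows from an upper bound on the Hessian. -/
lemma le_taylor_of_hessian_le (hV : Differentiable ℝ V) (hG : Differentiable ℝ (gradient V))
    (hM : ∀ x v, inner ℝ (fderiv ℝ (gradient V) x v) v ≤ quadForm M v) (x h : Vec n) :
    V (x + h) ≤ V x + inner ℝ h (gradient V x) + 1 / 2 * quadForm M h := by
  have hline : ∀ t : ℝ, HasDerivAt (fun t : ℝ => x + t • h) h t := fun t => by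
    simpa using ((hasDerivAt_id t).smul_const h).const_add x
  have h1 : ∀ t : ℝ, HasDerivAt (fun t : ℝ => V (x + t • h))
      (inner ℝ (gradient V (x + t • h)) h) t := fun t => by
    rw [inner_gradient_left]
    exact (hV (x + t • h)).hasFDerivAt.comp_hasDerivAt t (hline t)
  have h2 : ∀ t : ℝ, HasDerivAt (fun t : ℝ => inner ℝ (gradient V (x + t • h)) h)
      (inner ℝ (fderiv ℝ (gradient V) (x + t • h) h) h) t := fun t => by
    have := ((hG (x + t • h)).hasFDerivAt.comp_hasDerivAt t (hline t)).inner ℝ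
      (hasDerivAt_const t h)
    simpa using this
  have h3 : ∀ t : ℝ, HasDerivAt
      (fun t : ℝ => inner ℝ (gradient V (x + t • h)) h - t * quadForm M h)
      (inner ℝ (fderiv ℝ (gradient V) (x + t • h) h) h - quadForm M h) t := fun t => by
    exact ((h2 t).sub ((hasDerivAt_id t).mul_const (quadForm M h))).congr_deriv (by simp)
  -- The Hessian need not be continuous, so no integral remainder is used. Monotonicity is applied
  -- twice instead: to the derivative along the segment minus `t * quadForm M h`, then to `V` minus
  -- its quadratic majorant.
  have hanti : Antitone
      (fun t : ℝ => inner ℝ (gradient V (x + t • h)) h - t * quadForm M h) :=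
    antitone_of_deriv_nonpos (fun t => (h3 t).differentiableAt) fun t => by
      rw [(h3 t).deriv]; linarith [hM (x + t • h) h]
  have h4 : ∀ t : ℝ, HasDerivAt
      (fun t : ℝ => V (x + t • h) - t * inner ℝ (gradient V x) h - t ^ 2 / 2 * quadForm M h)
      (inner ℝ (gradient V (x + t • h)) h - inner ℝ (gradient V x) h - t * quadForm M h) t :=
    fun t => by
      have := ((h1 t).sub ((hasDerivAt_id t).mul_const (inner ℝ (gradient V x) h))).sub
        ((((hasDerivAt_id t).pow 2).div_const 2).mul_const (quadForm M h))
      refine this.congr_deriv ?_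
      simp
  have hmain : AntitoneOn
      (fun t : ℝ => V (x + t • h) - t * inner ℝ (gradient V x) h - t ^ 2 / 2 * quadForm M h)
      (Ici 0) := by
    refine antitoneOn_of_deriv_nonpos (convex_Ici 0)
      (fun t _ => (h4 t).continuousAt.continuousWithinAt)
      (fun t _ => (h4 t).differentiableAt.differentiableWithinAt) fun t ht => ?_
    rw [interior_Ici, mem_Ioi] at ht
    rw [(h4 t).deriv]
    have := hanti ht.le
    simp only [zero_smul, add_zero, zero_mul, sub_zero] at this
    linarith
  have := hmain (mem_Ici.2 le_rfl) (mem_Ici.2 zero_le_one) zero_le_one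
  simp only [zero_smul, add_zero, zero_mul, sub_zero, one_smul, one_mul] at this
  rw [real_inner_comm]
  norm_num at this ⊢
  linarith

end Taylor

/-! ### Coercivity and sublevel sets of the potential. -/

namespace LyapunovAssumptions

variable {n : ℕ} {φ : Vec n → Vec n} {xs : Vec n} {γ₀ : ℝ} {S M : Matrix (Fin n) (Fin n) ℝ}
  {V : Vec n → ℝ}

lemma continuous_V (h : LyapunovAssumptions φ xs γ₀ S V M) : Continuous V :=
  h.differentiable.continuous

lemma continuous_inner_gradient (h : LyapunovAssumptions φ xs γ₀ S V M) :
    Continuous fun x => inner ℝ (φ x) (gradient V x) :=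
  h.continuous_field.inner h.differentiable_gradient.continuous

lemma step_le (h : LyapunovAssumptions φ xs γ₀ S V M) (x w : Vec n) (g : ℝ) :
    V (x - g • w) ≤ V x - g * inner ℝ w (gradient V x) + g ^ 2 * (1 / 2 * quadForm M w) := by
  have := le_taylor_of_hessian_le h.differentiable h.differentiable_gradient h.hessian_le
    x (-(g • w))
  rw [← neg_smul, real_inner_smul_left, quadForm_smul, neg_smul, ← sub_eq_add_neg] at this
  linarith

lemma gradient_ne_zero (h : LyapunovAssumptions φ xs γ₀ S V M) {x : Vec n} (hx : x ≠ xs) :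
    gradient V x ≠ 0 := fun h0 => by
  have := h.descent x hx
  simp [h0] at this

/-- A zero of the nonnegative `V` is a minimum, hence a critical point, and the descent inequality
excludes critical points other than `xs`. -/
lemma pos (h : LyapunovAssumptions φ xs γ₀ S V M) {x : Vec n} (hx : x ≠ xs) : 0 < V x := by
  refine (h.nonneg x).lt_of_ne fun h0 => h.gradient_ne_zero hx ?_
  have hmin : IsLocalMin V x := Eventually.of_forall fun z => h0 ▸ h.nonneg z
  simp [gradient, hmin.fderiv_eq_zero]

/-- A step along the field of at most the maximal length does not increase `V`. -/
lemma noiseless_step_le (h : LyapunovAssumptions φ xs γ₀ S V M) {g : ℝ} (hg : 0 < g)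
    (hg' : g ≤ γ₀) (x : Vec n) : V (x - g • φ x) ≤ V x := by
  have hlt : ∀ g' : ℝ, g' ∈ Ioo 0 γ₀ → V (x - g' • φ x) ≤ V x := fun g' hg' => by
    simpa using (h.deterministic g' hg'.1 hg'.2 x).2 (zero_le_one (α := ℕ))
  -- The constant-step hypothesis covers only lengths below `γ₀`; the maximal length is reached by
  -- continuity.
  have hcl : g ∈ closure (Ioo 0 γ₀) := by
    rw [closure_Ioo (hg.trans_le hg').ne]; exact ⟨hg.le, hg'⟩
  have hclosed : IsClosed {g' : ℝ | V (x - g' • φ x) ≤ V x} :=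
    isClosed_le (h.continuous_V.comp (by fun_prop)) continuous_const
  exact closure_minimal (fun g' hg' => hlt g' hg') hclosed hcl

/-- Outside a ball the potential decreases along the field proportionally to the step length. -/
lemma exists_add_norm_le (h : LyapunovAssumptions φ xs γ₀ S V M) (hγ : 0 < γ₀)
    (htr : 0 ≤ (S * M).trace) : ∃ R c : ℝ, 0 < c ∧ ∀ x, R ≤ ‖x - xs‖ →
      V (x - (γ₀ / 2) • φ x) + c * ‖(γ₀ / 2) • φ x‖ ≤ V x := by
  obtain ⟨R, β, -, hβ, hfar⟩ := h.far_field
  obtain ⟨m, hm, hq⟩ := exists_le_quadForm h.posDef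
  -- With half the maximal step, the far-field inequality pays for the second-order term and leaves
  -- a surplus of `g * β + g ^ 2 / 2 * quadForm M (φ x)`. The second part controls the squared
  -- displacement and the first a constant, and `N ≤ 1 + N ^ 2` turns this into a linear bound.
  set g := γ₀ / 2 with hg
  have hg0 : 0 < g := by positivity
  refine ⟨R, min (g * β) (m / 2), by positivity, fun x hx => ?_⟩
  have h1 := h.step_le x (φ x) g
  have h2 := hfar x hx
  have h3 := hq (φ x)
  have hγg : γ₀ = 2 * g := by rw [hg]; ring
  rw [norm_smul, Real.norm_of_nonneg hg0.le]
  have key : min (g * β) (m / 2) * (g * ‖φ x‖) ≤ g * β + g ^ 2 * (1 / 2 * quadForm M (φ x)) := by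
    have ha : 0 < min (g * β) (m / 2) := by positivity
    have hb : min (g * β) (m / 2) ≤ g * β := min_le_left _ _
    have hc : min (g * β) (m / 2) ≤ m / 2 := min_le_right _ _
    have hN : 0 ≤ g * ‖φ x‖ := by positivity
    have h5 : g * ‖φ x‖ ≤ 1 + (g * ‖φ x‖) ^ 2 := by nlinarith [sq_nonneg (g * ‖φ x‖ - 1)]
    calc _ ≤ min (g * β) (m / 2) * (1 + (g * ‖φ x‖) ^ 2) := by gcongr
      _ = min (g * β) (m / 2) + min (g * β) (m / 2) * (g * ‖φ x‖) ^ 2 := by ring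
      _ ≤ g * β + m / 2 * (g * ‖φ x‖) ^ 2 := by gcongr
      _ = g * β + g ^ 2 * (1 / 2 * (m * ‖φ x‖ ^ 2)) := by ring
      _ ≤ _ := by gcongr
  have h4 := mul_le_mul_of_nonneg_left h2 hg0.le
  rw [hγg] at h4
  nlinarith [mul_nonneg (mul_nonneg hg0.le hg0.le) htr]

/-- The potential grows at least linearly. -/
lemma coercive (h : LyapunovAssumptions φ xs γ₀ S V M) (hγ : 0 < γ₀)
    (htr : 0 ≤ (S * M).trace) : ∃ R c : ℝ, 0 < c ∧ ∀ x, c * (‖x - xs‖ - R) ≤ V x := by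
  obtain ⟨R, c, hc, hstep⟩ := h.exists_add_norm_le hγ htr
  have hR : ∀ R', R ≤ R' → ∀ x, R' ≤ ‖x - xs‖ →
      V (x - (γ₀ / 2) • φ x) + c * ‖(γ₀ / 2) • φ x‖ ≤ V x := fun R' hR' x hx =>
    hstep x (hR'.trans hx)
  set R' := max R 1
  -- Telescoping along the noise-free iteration: each step taken outside the ball costs at least `c`
  -- times its length, and the iteration does reach the ball. So `V z` pays for the distance from
  -- `z` to the ball.
  have hind : ∀ (k : ℕ) (z : Vec n), ‖(fun z => z - (γ₀ / 2) • φ z)^[k] z - xs‖ < R' →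
      c * (‖z - xs‖ - R') ≤ V z := by
    intro k
    induction k with
    | zero =>
      intro z hz
      have : c * (‖z - xs‖ - R') ≤ 0 :=
        mul_nonpos_of_nonneg_of_nonpos hc.le (by simpa using hz.le)
      exact this.trans (h.nonneg z)
    | succ k ih =>
      intro z hz
      rcases lt_or_ge ‖z - xs‖ R' with hlt | hge
      · exact (mul_nonpos_of_nonneg_of_nonpos hc.le (by linarith)).trans (h.nonneg z)
      · have h1 := ih _ hz
        have h2 := hR R' (le_max_left _ _) z hge
        have h3 : ‖z - xs‖ ≤ ‖z - (γ₀ / 2) • φ z - xs‖ + ‖(γ₀ / 2) • φ z‖ := by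
          refine le_trans (le_of_eq ?_) (norm_add_le _ _)
          congr 1; abel
        simp only at h1
        nlinarith
  refine ⟨R', c, hc, fun z => ?_⟩
  have hlim := (h.deterministic (γ₀ / 2) (by positivity) (by linarith) z).1
  have hev := hlim.eventually (Metric.ball_mem_nhds xs (by positivity : 0 < R'))
  obtain ⟨k, hk⟩ := hev.exists
  exact hind k z (by simpa [dist_eq_norm] using hk)

lemma exists_norm_le (h : LyapunovAssumptions φ xs γ₀ S V M) (hγ : 0 < γ₀)
    (htr : 0 ≤ (S * M).trace) (v : ℝ) : ∃ r : ℝ, ∀ x, V x ≤ v → ‖x - xs‖ ≤ r := by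
  obtain ⟨R, c, hc, hcoer⟩ := h.coercive hγ htr
  refine ⟨v / c + R, fun x hx => ?_⟩
  have := (hcoer x).trans hx
  rw [← le_div_iff₀' hc] at this
  linarith

lemma isCompact_sublevel (h : LyapunovAssumptions φ xs γ₀ S V M) (hγ : 0 < γ₀)
    (htr : 0 ≤ (S * M).trace) (v : ℝ) : IsCompact {x | V x ≤ v} := by
  obtain ⟨r, hr⟩ := h.exists_norm_le hγ htr v
  refine (isCompact_closedBall xs r).of_isClosed_subset
    (isClosed_le h.continuous_V continuous_const) fun x hx => ?_
  simpa [dist_eq_norm] using hr x hx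

/-- Small sublevel sets of the potential are contained in small balls. -/
lemma exists_sublevel_subset_ball (h : LyapunovAssumptions φ xs γ₀ S V M) (hγ : 0 < γ₀)
    (htr : 0 ≤ (S * M).trace) {r : ℝ} (hr : 0 < r) :
    ∃ ε : ℝ, 0 < ε ∧ ∀ x, V x ≤ ε → ‖x - xs‖ < r := by
  have hK : IsCompact ({x | V x ≤ 1} ∩ (Metric.ball xs r)ᶜ) :=
    (h.isCompact_sublevel hγ htr 1).inter_right Metric.isOpen_ball.isClosed_compl
  obtain ⟨ε, hε, hle⟩ := hK.exists_forall_le' h.continuous_V.continuousOn (a := 0)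
    (fun x hx => h.pos (by rintro rfl; exact hx.2 (Metric.mem_ball_self hr)))
  refine ⟨min (ε / 2) 1, by positivity, fun x hx => ?_⟩
  by_contra hcon
  have := hle x ⟨hx.trans (min_le_right _ _), by simpa [dist_eq_norm] using hcon⟩
  have := hx.trans (min_le_left _ _)
  linarith

lemma tendsto_of_tendsto_zero (h : LyapunovAssumptions φ xs γ₀ S V M) (hγ : 0 < γ₀)
    (htr : 0 ≤ (S * M).trace) {x : ℕ → Vec n} (hx : Tendsto (fun t => V (x t)) atTop (𝓝 0)) :
    Tendsto x atTop (𝓝 xs) := by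
  rw [Metric.tendsto_atTop']
  intro r hr
  obtain ⟨ε, hε, hsub⟩ := h.exists_sublevel_subset_ball hγ htr hr
  obtain ⟨N, hN⟩ := eventually_atTop.1 (hx.eventually (gt_mem_nhds hε))
  exact ⟨N, fun t ht => by simpa [dist_eq_norm] using hsub _ (hN t ht.le).le⟩

end LyapunovAssumptions

/-! ### Perturbations of the field that lower the potential. -/

namespace LyapunovAssumptions

variable {n : ℕ} {φ : Vec n → Vec n} {xs : Vec n} {γ₀ : ℝ} {S M : Matrix (Fin n) (Fin n) ℝ}
  {V : Vec n → ℝ}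

/-- Some small perturbation of the field strictly decreases the potential. -/
lemma exists_perturbed_step_lt (h : LyapunovAssumptions φ xs γ₀ S V M) {ρ : ℝ} (hρ : 0 < ρ)
    {g : ℝ} (hg : 0 < g) (hg' : g ≤ γ₀) {x : Vec n} (hx : x ≠ xs) :
    ∃ w, ‖w‖ ≤ ρ ∧ V (x - g • (φ x + w)) < V x := by
  by_cases hz : x - g • φ x = xs
  · exact ⟨0, by simpa using hρ.le, by simpa [hz, h.zero] using h.pos hx⟩
  set z := x - g • φ x with hz_def
  have hG := h.gradient_ne_zero hz
  -- The noise-free step is only known not to increase `V`, so strictness must come from the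
  -- perturbation. If none helped, `0` would be a local minimum of `w ↦ V (z - g • w)`, making `z ≠
  -- xs` a critical point.
  by_contra! hcon
  have hmin : IsLocalMin (fun w => V (z - g • w)) 0 := by
    filter_upwards [Metric.closedBall_mem_nhds (0 : Vec n) hρ] with w hw
    have h1 := hcon w (by simpa using hw)
    rw [smul_add, ← sub_sub, ← hz_def] at h1
    simpa using (h.noiseless_step_le hg hg' x).trans h1
  have hd : HasFDerivAt (fun w => V (z - g • w))
      ((fderiv ℝ V z).comp (-(g • ContinuousLinearMap.id ℝ (Vec n)))) 0 := by
    have hin : HasFDerivAt (fun w : Vec n => z - g • w)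
        (-(g • ContinuousLinearMap.id ℝ (Vec n))) 0 :=
      ((hasFDerivAt_id (𝕜 := ℝ) (0 : Vec n)).const_smul g).const_sub z
    have hV : HasFDerivAt V (fderiv ℝ V z) (z - g • (0 : Vec n)) := by
      simpa using (h.differentiable z).hasFDerivAt
    exact hV.comp 0 hin
  have h0 := hmin.hasFDerivAt_eq_zero hd
  have h1 := congrArg (fun L => L (gradient V z)) h0
  simp only [ContinuousLinearMap.comp_apply, neg_apply,
    smul_apply, ContinuousLinearMap.id_apply, map_neg, map_smul,
    ← inner_gradient_left, zero_apply, neg_eq_zero, smul_eq_mul] at h1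
  rcases mul_eq_zero.1 h1 with h2 | h2
  · exact hg.ne' h2
  · exact hG (inner_self_eq_zero.1 h2)

/-- On a compact set away from the stationary point, and for steps of all lengths, some small
perturbation of the field decreases the potential proportionally to the step length. -/
lemma exists_perturbed_step_le (h : LyapunovAssumptions φ xs γ₀ S V M) (hγ : 0 < γ₀)
    {ρ : ℝ} (hρ : 0 < ρ) {K : Set (Vec n)} (hK : IsCompact K) (hxs : xs ∉ K) :
    ∃ c : ℝ, 0 < c ∧ ∀ x ∈ K, ∀ g, 0 < g → g ≤ γ₀ →
      ∃ w, ‖w‖ ≤ ρ ∧ V (x - g • (φ x + w)) ≤ V x - c * g := by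
  obtain ⟨d, hd, hdle⟩ := hK.exists_forall_le' h.continuous_inner_gradient.continuousOn (a := 0)
    (fun x hx => h.descent x (fun h' => hxs (h' ▸ hx)))
  obtain ⟨Q, hQ⟩ := (hK.image ((continuous_quadForm M).comp h.continuous_field)).bddAbove
  have hQ' : ∀ x ∈ K, quadForm M (φ x) ≤ max Q 1 := fun x hx =>
    (hQ (mem_image_of_mem _ hx)).trans (le_max_left _ _)
  have hQ0 : 0 < max Q 1 := by positivity
  -- Up to this length the second-order term is at most half of the first-order decrease, so no
  -- perturbation is needed.
  set g₁ := d / max Q 1 with hg₁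
  have hg₁0 : 0 < g₁ := by positivity
  -- For the remaining lengths a strict decrease at each point of a compact set becomes uniform: a
  -- perturbation that works at one pair `(x, g)` works nearby.
  obtain ⟨δ, hδ, hδle⟩ : ∃ δ : ℝ, 0 < δ ∧ ∀ p ∈ K ×ˢ Icc g₁ γ₀,
      ∃ w, ‖w‖ ≤ ρ ∧ V (p.1 - p.2 • (φ p.1 + w)) ≤ V p.1 - δ := by
    refine (hK.prod isCompact_Icc).induction_on
      (p := fun s => ∃ δ : ℝ, 0 < δ ∧ ∀ p ∈ s,
        ∃ w, ‖w‖ ≤ ρ ∧ V (p.1 - p.2 • (φ p.1 + w)) ≤ V p.1 - δ) ?_ ?_ ?_ ?_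
    · exact ⟨1, one_pos, by simp⟩
    · rintro s t hst ⟨δ, hδ, ht⟩
      exact ⟨δ, hδ, fun p hp => ht p (hst hp)⟩
    · rintro s t ⟨δ, hδ, hs⟩ ⟨δ', hδ', ht⟩
      refine ⟨min δ δ', lt_min hδ hδ', ?_⟩
      rintro p (hp | hp)
      · obtain ⟨w, hw, hle⟩ := hs p hp
        exact ⟨w, hw, hle.trans (by linarith [min_le_left δ δ'])⟩
      · obtain ⟨w, hw, hle⟩ := ht p hp
        exact ⟨w, hw, hle.trans (by linarith [min_le_right δ δ'])⟩
    · rintro ⟨x, g⟩ ⟨hx, hg⟩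
      obtain ⟨w, hw, hlt⟩ := h.exists_perturbed_step_lt hρ (hg₁0.trans_le hg.1) hg.2
        (x := x) (fun h' => hxs (h' ▸ hx))
      set δ := (V x - V (x - g • (φ x + w))) / 2 with hδ
      have hδ0 : 0 < δ := by rw [hδ]; linarith
      have hφ := h.continuous_field
      have hV := h.continuous_V
      have hcont : Continuous fun p : Vec n × ℝ => V p.1 - V (p.1 - p.2 • (φ p.1 + w)) := by
        fun_prop
      refine ⟨{p | δ < V p.1 - V (p.1 - p.2 • (φ p.1 + w))}, mem_nhdsWithin_of_mem_nhds
        ((isOpen_lt continuous_const hcont).mem_nhds ?_), δ, hδ0, fun p hp => ⟨w, hw, ?_⟩⟩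
      · simp only [mem_ofPred_eq]; rw [hδ]; linarith
      · simp only [mem_ofPred_eq] at hp; linarith
  refine ⟨min (d / 2) (δ / γ₀), by positivity, fun x hx g hg hg' => ?_⟩
  rcases le_total g g₁ with hle | hle
  · refine ⟨0, by simpa using hρ.le, ?_⟩
    have h1 := h.step_le x (φ x) g
    have h2 := hdle x hx
    have h3 := hQ' x hx
    have h4 : g * max Q 1 ≤ d := by rwa [hg₁, le_div_iff₀ hQ0] at hle
    have h5 : g * quadForm M (φ x) ≤ d :=
      (mul_le_mul_of_nonneg_left h3 hg.le).trans h4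
    have h6 := min_le_left (d / 2) (δ / γ₀)
    rw [add_zero]
    nlinarith [mul_le_mul_of_nonneg_left h5 hg.le, mul_le_mul_of_nonneg_left h2 hg.le,
      mul_le_mul_of_nonneg_left h6 hg.le]
  · obtain ⟨w, hw, hle'⟩ := hδle (x, g) ⟨hx, hle, hg'⟩
    refine ⟨w, hw, hle'.trans ?_⟩
    have h6 := min_le_right (d / 2) (δ / γ₀)
    have h7 : min (d / 2) (δ / γ₀) * g ≤ δ / γ₀ * γ₀ := by gcongr
    rw [div_mul_cancel₀ _ hγ.ne'] at h7
    simp only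
    linarith

/-- A robust form of `exists_perturbed_step_le`, with a ball of perturbations. -/
lemma exists_ball_perturbed_step_le (h : LyapunovAssumptions φ xs γ₀ S V M) (hγ : 0 < γ₀)
    {ρ : ℝ} (hρ : 0 < ρ) {K : Set (Vec n)} (hK : IsCompact K) (hxs : xs ∉ K) :
    ∃ c η : ℝ, 0 < c ∧ 0 < η ∧ ∀ x ∈ K, ∀ g, 0 < g → g ≤ γ₀ →
      ∃ w₀, ‖w₀‖ ≤ ρ ∧ ∀ w ∈ Metric.ball w₀ η, V (x - g • (φ x + w)) ≤ V x - c * g := by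
  obtain ⟨c, hc, hstep⟩ := h.exists_perturbed_step_le hγ hρ hK hxs
  obtain ⟨A, hA⟩ := hK.isBounded.exists_norm_le
  obtain ⟨B, hB⟩ := (hK.image h.continuous_field).isBounded.exists_norm_le
  -- A radius that contains all end points of the perturbed steps; `V` is Lipschitz there. Changing
  -- `w` moves the end point by `g * ‖w - w₀‖`, so the loss is also proportional to `g`, and `η` can
  -- be chosen independently of `g`.
  set r := A + γ₀ * (B + (ρ + 1)) with hr
  obtain ⟨L, hL⟩ := ((isCompact_closedBall (0 : Vec n) r).image
    h.differentiable_gradient.continuous).isBounded.exists_norm_le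
  have hlip : ∀ a ∈ Metric.closedBall (0 : Vec n) r, ∀ b ∈ Metric.closedBall (0 : Vec n) r,
      ‖V b - V a‖ ≤ max L 1 * ‖b - a‖ := fun a ha b hb => by
    refine (convex_closedBall (0 : Vec n) r).norm_image_sub_le_of_norm_fderiv_le (𝕜 := ℝ)
      (fun z _ => h.differentiable z) (fun z hz => ?_) ha hb
    have := hL _ (mem_image_of_mem _ hz)
    rw [gradient, LinearIsometryEquiv.norm_map] at this
    exact this.trans (le_max_left _ _)
  have hL0 : 0 < max L 1 := by positivity
  refine ⟨c / 2, min 1 (c / 2 / max L 1), by positivity, by positivity, fun x hx g hg hg' => ?_⟩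
  obtain ⟨w₀, hw₀, hle⟩ := hstep x hx g hg hg'
  refine ⟨w₀, hw₀, fun w hw => ?_⟩
  rw [Metric.mem_ball, dist_eq_norm] at hw
  have hmem : ∀ w', ‖w'‖ ≤ ρ + 1 → x - g • (φ x + w') ∈ Metric.closedBall (0 : Vec n) r := by
    intro w' hw'
    rw [mem_closedBall_zero_iff, hr]
    refine (norm_sub_le _ _).trans ?_
    rw [norm_smul, Real.norm_of_nonneg hg.le]
    have h1 := hA x hx
    have h2 := hB _ (mem_image_of_mem _ hx)
    have h3 : ‖φ x + w'‖ ≤ B + (ρ + 1) := (norm_add_le _ _).trans (add_le_add h2 hw')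
    gcongr
  have hw' : ‖w‖ ≤ ρ + 1 := by
    have := norm_le_norm_add_norm_sub' w w₀
    linarith [min_le_left 1 (c / 2 / max L 1)]
  have h1 := hlip _ (hmem w₀ (by linarith)) _ (hmem w hw')
  have h2 : x - g • (φ x + w) - (x - g • (φ x + w₀)) = -(g • (w - w₀)) := by
    simp only [smul_add, smul_sub]; abel
  rw [h2, norm_neg, norm_smul, Real.norm_of_nonneg hg.le] at h1
  have h3 : max L 1 * (g * ‖w - w₀‖) ≤ g * (c / 2) := by
    have : ‖w - w₀‖ ≤ c / 2 / max L 1 := hw.le.trans (min_le_right _ _)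
    rw [le_div_iff₀ hL0] at this
    nlinarith
  have h4 := (le_abs_self _).trans (h1.trans h3)
  linarith

end LyapunovAssumptions

/-! ### Mean change of the potential in one noisy step. -/

section Drift

variable {n : ℕ} {μ : Measure (Vec n)} [IsProbabilityMeasure μ]

/-- The mean of a quadratic form at a centred random displacement of a point. -/
lemma integral_quadForm_add (hμ : MemLp id 2 μ) (hmean : ∫ w, w ∂μ = 0)
    {M : Matrix (Fin n) (Fin n) ℝ} (hM : M.IsSymm) (p : Vec n) :
    Integrable (fun w => quadForm M (p + w)) μ ∧
      ∫ w, quadForm M (p + w) ∂μ = quadForm M p + (covMatrix μ id * M).trace := by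
  have hint : Integrable (fun w : Vec n => w) μ := hμ.integrable one_le_two
  have hc : ∀ i, MemLp (fun w : Vec n => w i) 2 μ := fun i =>
    (EuclideanSpace.proj (𝕜 := ℝ) i).comp_memLp' hμ
  have hci : ∀ i, Integrable (fun w : Vec n => w i) μ := fun i => (hc i).integrable one_le_two
  have hc0 : ∀ i, ∫ w : Vec n, w i ∂μ = 0 := fun i => by
    have := (EuclideanSpace.proj (𝕜 := ℝ) i : Vec n →L[ℝ] ℝ).integral_comp_comm hint
    rw [hmean] at this
    simpa using this
  have hprod : ∀ i j, Integrable (fun w : Vec n => w i * w j) μ := fun i j =>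
    (hc i).integrable_mul (hc j)
  have hterm : ∀ i j, Integrable (fun w : Vec n => (p + w) i * M i j * (p + w) j) μ ∧
      ∫ w : Vec n, (p + w) i * M i j * (p + w) j ∂μ
        = p i * M i j * p j + M i j * covMatrix μ id i j := fun i j => by
    have heq : (fun w : Vec n => (p + w) i * M i j * (p + w) j) = fun w =>
        (p i * M i j * p j + p i * M i j * w j) + (M i j * p j * w i + M i j * (w i * w j)) := by
      funext w; simp only [PiLp.add_apply]; ring
    have i1 := (integrable_const (μ := μ) (p i * M i j * p j)).add
      ((hci j).const_mul (p i * M i j))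
    have i2 := ((hci i).const_mul (M i j * p j)).add ((hprod i j).const_mul (M i j))
    rw [heq]
    refine ⟨i1.add i2, ?_⟩
    rw [integral_add (by exact i1) (by exact i2),
      integral_add (integrable_const _) ((hci j).const_mul _),
      integral_add ((hci i).const_mul _) ((hprod i j).const_mul _),
      integral_const_mul, integral_const_mul, integral_const_mul, hc0, hc0]
    simp [covMatrix, integral_const_mul]
  refine ⟨?_, ?_⟩
  · exact integrable_finsetSum _ fun i _ => integrable_finsetSum _ fun j _ => (hterm i j).1
  · simp only [quadForm]
    rw [integral_finsetSum _ fun i _ => integrable_finsetSum _ fun j _ => (hterm i j).1]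
    simp_rw [integral_finsetSum _ fun j _ => (hterm _ j).1, (hterm _ _).2,
      Finset.sum_add_distrib]
    congr 1
    simp only [Matrix.trace, Matrix.diag, Matrix.mul_apply]
    refine Finset.sum_congr rfl fun i _ => Finset.sum_congr rfl fun j _ => ?_
    rw [← hM.apply i j, mul_comm]

/-- The trace is the mean of a nonnegative quadratic form at the noise. -/
lemma trace_covMatrix_mul_nonneg (hμ : MemLp id 2 μ) (hmean : ∫ w, w ∂μ = 0)
    {M : Matrix (Fin n) (Fin n) ℝ} (hM : M.PosDef) : 0 ≤ (covMatrix μ id * M).trace := by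
  have h := (integral_quadForm_add hμ hmean (by simpa using hM.isHermitian) 0).2
  have h0 : quadForm M 0 = 0 := by simp [quadForm]
  rw [h0, zero_add] at h
  rw [← h]
  exact integral_nonneg fun w => quadForm_nonneg hM _

variable {φ : Vec n → Vec n} {xs : Vec n} {γ₀ : ℝ} {M : Matrix (Fin n) (Fin n) ℝ}
  {V : Vec n → ℝ}

/-- The mean of the potential after one noisy step. -/
lemma LyapunovAssumptions.integral_step_le (h : LyapunovAssumptions φ xs γ₀ (covMatrix μ id) V M)
    (hμ : MemLp id 2 μ) (hmean : ∫ w, w ∂μ = 0) (x : Vec n) (g : ℝ) :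
    Integrable (fun w => V (x - g • (φ x + w))) μ ∧
    ∫ w, V (x - g • (φ x + w)) ∂μ ≤ V x - g * inner ℝ (φ x) (gradient V x)
      + g ^ 2 * (1 / 2 * (quadForm M (φ x) + (covMatrix μ id * M).trace)) := by
  have hint : Integrable (fun w : Vec n => w) μ := hμ.integrable one_le_two
  obtain ⟨hq, hq'⟩ := integral_quadForm_add hμ hmean (M := M)
    (by simpa using h.posDef.isHermitian) (φ x)
  have hin : Integrable (fun w : Vec n => inner ℝ w (gradient V x)) μ := hint.inner_const _
  have hin0 : ∫ w : Vec n, inner ℝ w (gradient V x) ∂μ = 0 := by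
    rw [integral_congr_ae (ae_of_all μ fun w => real_inner_comm (gradient V x) w),
      integral_inner hint, hmean, inner_zero_right]
  have i1 := (integrable_const (μ := μ) (V x - g * inner ℝ (φ x) (gradient V x))).sub
    (hin.const_mul g)
  have i2 := (hq.const_mul (1 / 2)).const_mul (g ^ 2)
  have hle : ∀ w, V (x - g • (φ x + w)) ≤ (V x - g * inner ℝ (φ x) (gradient V x)
      - g * inner ℝ w (gradient V x)) + g ^ 2 * (1 / 2 * quadForm M (φ x + w)) := fun w => by
    have := h.step_le x (φ x + w) g
    rw [inner_add_left] at this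
    linarith
  have hbound := i1.add i2
  have hi : Integrable (fun w => V (x - g • (φ x + w))) μ := by
    refine hbound.mono' ?_ (ae_of_all _ fun w => ?_)
    · exact (h.continuous_V.comp (by fun_prop)).aestronglyMeasurable
    · rw [Real.norm_of_nonneg (h.nonneg _)]
      exact hle w
  refine ⟨hi, (integral_mono hi hbound hle).trans (le_of_eq ?_)⟩
  simp only [Pi.add_apply, Pi.sub_apply]
  rw [integral_add (by exact i1) (by exact i2), integral_sub (integrable_const _) (hin.const_mul g),
    integral_const_mul, integral_const_mul, integral_const_mul, hin0, hq']
  simp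

/-- The drift of the potential: at least proportional to the step outside a ball, and up to a
quadratic term everywhere. -/
lemma LyapunovAssumptions.exists_drift (h : LyapunovAssumptions φ xs γ₀ (covMatrix μ id) V M)
    (hμ : MemLp id 2 μ) (hmean : ∫ w, w ∂μ = 0) :
    ∃ R β C : ℝ, 0 < R ∧ 0 < β ∧ 0 ≤ C ∧ ∀ x g, 0 ≤ g → g ≤ γ₀ →
      (R ≤ ‖x - xs‖ → ∫ w, V (x - g • (φ x + w)) ∂μ ≤ V x - g * β) ∧
      ∫ w, V (x - g • (φ x + w)) ∂μ
        ≤ V x - g * min (inner ℝ (φ x) (gradient V x)) β + C * g ^ 2 := by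
  obtain ⟨R, β, hR, hβ, hfar⟩ := h.far_field
  have htr := trace_covMatrix_mul_nonneg hμ hmean h.posDef
  obtain ⟨Q, hQ⟩ := ((isCompact_closedBall xs R).image
    ((continuous_quadForm M).comp h.continuous_field)).bddAbove
  -- Inside the ball the second-order term is bounded by compactness; outside it is absorbed by the
  -- far-field inequality, because `g ≤ γ₀`. Truncating the descent term at `β` makes one estimate
  -- valid in both regions.
  set C := 1 / 2 * (max Q 0 + (covMatrix μ id * M).trace) with hC
  have hC0 : 0 ≤ C := by positivity
  refine ⟨R, β, C, hR, hβ, hC0, fun x g hg hg' => ?_⟩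
  have h1 := (h.integral_step_le hμ hmean x g).2
  have hf : R ≤ ‖x - xs‖ → ∫ w, V (x - g • (φ x + w)) ∂μ ≤ V x - g * β := fun hx => by
    have h2 := mul_le_mul_of_nonneg_left (hfar x hx) hg
    have h3 : 0 ≤ 1 / 2 * (quadForm M (φ x) + (covMatrix μ id * M).trace) := by
      have := quadForm_nonneg h.posDef (φ x); positivity
    nlinarith [mul_nonneg (mul_nonneg hg (sub_nonneg.2 hg')) h3]
  refine ⟨hf, ?_⟩
  have hmin := min_le_right (inner ℝ (φ x) (gradient V x)) β
  have hmin' := min_le_left (inner ℝ (φ x) (gradient V x)) β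
  rcases le_total R ‖x - xs‖ with hx | hx
  · nlinarith [hf hx, mul_le_mul_of_nonneg_left hmin hg, mul_nonneg hC0 (sq_nonneg g)]
  · have h2 : quadForm M (φ x) ≤ max Q 0 := (hQ (mem_image_of_mem _
      (by simpa [dist_eq_norm] using hx))).trans (le_max_left _ _)
    have h3 : 1 / 2 * (quadForm M (φ x) + (covMatrix μ id * M).trace) ≤ C := by
      rw [hC]; linarith
    nlinarith [mul_le_mul_of_nonneg_left hmin' hg, mul_le_mul_of_nonneg_left h3 (sq_nonneg g)]

end Drift

/-! ### Sums of the step function along arithmetic progressions. -/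

section StepSizes

/-- The properties of an everywhere defined step function that the convergence proof uses. -/
structure IsStepFunction (γ : ℝ → ℝ) : Prop where
  antitone : Antitone γ
  pos : ∀ r, 0 < γ r
  tendsto_sum : ∀ a b : ℝ, 0 ≤ a → 0 < b →
    Tendsto (fun N : ℕ => ∑ k ∈ Finset.range N, γ (a + b * k)) atTop atTop
  summable_sq : ∀ b : ℝ, 0 < b → Summable fun k : ℕ => γ (b * k) ^ 2

namespace StepAssumptions

variable {γ : ℝ → ℝ}

lemma intervalIntegrable (h : StepAssumptions γ) {a b : ℝ} (ha : 0 ≤ a) (hb : 0 ≤ b) :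
    IntervalIntegrable γ volume a b :=
  (h.antitone.mono fun _ hx => mem_Ici.2 ((le_min ha hb).trans hx.1)).intervalIntegrable

/-- A nonpositive value would persist by monotonicity and keep the integral bounded above. -/
lemma pos (h : StepAssumptions γ) {r : ℝ} (hr : 0 ≤ r) : 0 < γ r := by
  by_contra! hcon
  obtain ⟨T, hT, hrT⟩ := ((h.integral_eq_top.eventually_gt_atTop (∫ r in (0 : ℝ)..r, γ r)).and
    (eventually_ge_atTop r)).exists
  rw [← intervalIntegral.integral_add_adjacent_intervals
    (h.intervalIntegrable le_rfl hr) (h.intervalIntegrable hr (hr.trans hrT))] at hT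
  have : ∫ z in r..T, γ z ≤ 0 := by
    have := intervalIntegral.integral_mono_on hrT (h.intervalIntegrable hr (hr.trans hrT))
      (intervalIntegrable_const (c := (0 : ℝ)))
      (fun z hz => (h.antitone hr (hr.trans hz.1) hz.1).trans hcon)
    simpa using this
  linarith

/-- Integral test: after the substitution `z = a + b * r`, a finite sum would bound the integral of
`γ`. -/
lemma not_summable (h : StepAssumptions γ) {a b : ℝ} (ha : 0 ≤ a) (hb : 0 < b) :
    ¬ Summable fun k : ℕ => γ (a + b * k) := fun hs => by
  have hanti : AntitoneOn (fun r : ℝ => γ (a + b * r)) (Ici 0) := fun r hr r' hr' hle =>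
    h.antitone (mem_Ici.2 (add_nonneg ha (mul_nonneg hb.le hr)))
      (mem_Ici.2 (add_nonneg ha (mul_nonneg hb.le hr'))) (by gcongr)
  have hint := hanti.integrableOn_Ioi_zero_of_summable hs
    (fun k hk => (h.pos (add_nonneg ha (mul_nonneg hb.le (mem_Ioi.1 hk).le))).le)
  obtain ⟨T, hT, hrT⟩ := ((h.integral_eq_top.eventually_gt_atTop
    ((∫ r in (0 : ℝ)..a, γ r) + b * ∫ r in Ioi (0 : ℝ), γ (a + b * r))).and
    (eventually_ge_atTop a)).exists
  rw [← intervalIntegral.integral_add_adjacent_intervals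
    (h.intervalIntegrable le_rfl ha) (h.intervalIntegrable ha (ha.trans hrT))] at hT
  have h1 : ∫ z in a..T, γ z = b * ∫ r in (0 : ℝ)..((T - a) / b), γ (a + b * r) := by
    have := intervalIntegral.mul_integral_comp_add_mul (f := γ) (a := 0) (b := (T - a) / b) b a
    rw [this]
    congr 1
    · ring
    · field_simp; ring
  have h2 : ∫ r in (0 : ℝ)..((T - a) / b), γ (a + b * r)
      ≤ ∫ r in Ioi (0 : ℝ), γ (a + b * r) := by
    have hT0 : 0 ≤ (T - a) / b := div_nonneg (by linarith) hb.le
    rw [intervalIntegral.integral_of_le hT0]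
    refine setIntegral_mono_set hint ?_ (Ioc_subset_Ioi_self.eventuallyLE)
    filter_upwards [self_mem_ae_restrict measurableSet_Ioi] with r hr
    exact (h.pos (add_nonneg ha (mul_nonneg hb.le (mem_Ioi.1 hr).le))).le
  have h3 := mul_le_mul_of_nonneg_left h2 hb.le
  linarith

lemma summable_sq (h : StepAssumptions γ) {b : ℝ} (hb : 0 < b) :
    Summable fun k : ℕ => γ (b * k) ^ 2 := by
  have hanti : AntitoneOn (fun r : ℝ => γ (b * r) ^ 2) (Ici 0) := fun r hr r' hr' hle => by
    have hr0 : 0 ≤ b * r := mul_nonneg hb.le hr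
    have hr0' : 0 ≤ b * r' := mul_nonneg hb.le hr'
    exact pow_le_pow_left₀ (h.pos hr0').le (h.antitone hr0 hr0' (by gcongr)) 2
  refine hanti.summable_of_integrableOn_Ioi_zero ?_ (fun k _ => sq_nonneg _)
  have := (integrableOn_Ioi_comp_mul_left_iff (fun r => γ r ^ 2) 0 hb).2
    (by rw [mul_zero]; exact h.integrable_sq.mono_set Ioi_subset_Ici_self)
  exact this

/-- The step function, extended to negative arguments by its value at zero. -/
lemma isStepFunction (h : StepAssumptions γ) : IsStepFunction fun r => γ (max r 0) where
  antitone := fun r r' hle =>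
    h.antitone (mem_Ici.2 (le_max_right _ _)) (mem_Ici.2 (le_max_right _ _))
      (max_le_max_right 0 hle)
  pos := fun r => h.pos (le_max_right _ _)
  tendsto_sum := fun a b ha hb => by
    have h1 : ∀ k : ℕ, max (a + b * k) 0 = a + b * k := fun k => max_eq_left (by positivity)
    simp_rw [h1]
    exact (not_summable_iff_tendsto_nat_atTop_of_nonneg
      fun k => (h.pos (by positivity)).le).1 (h.not_summable ha hb)
  summable_sq := fun b hb => by
    have h1 : ∀ k : ℕ, max (b * k) 0 = b * k := fun k => max_eq_left (by positivity)
    simp_rw [h1]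
    exact h.summable_sq hb

end StepAssumptions

namespace IsStepFunction

variable {γ : ℝ → ℝ}

lemma measurable (h : IsStepFunction γ) : Measurable γ := h.antitone.measurable

lemma tendsto_zero (h : IsStepFunction γ) : Tendsto γ atTop (𝓝 0) := by
  have h1 : Tendsto (fun k : ℕ => γ ((1 : ℝ) * k)) atTop (𝓝 0) := by
    have := (h.summable_sq 1 one_pos).tendsto_atTop_zero.sqrt
    simpa [Real.sqrt_sq (h.pos _).le] using this
  rw [Metric.tendsto_atTop] at h1 ⊢
  intro ε hε
  obtain ⟨N, hN⟩ := h1 ε hε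
  refine ⟨N, fun r hr => ?_⟩
  have h2 := hN N le_rfl
  rw [one_mul, Real.dist_0_eq_abs, abs_of_pos (h.pos _)] at h2
  rw [Real.dist_0_eq_abs, abs_of_pos (h.pos _)]
  exact (h.antitone hr).trans_lt h2

end IsStepFunction

end StepSizes

/-! ### Integrating out the independent noise with the past frozen. -/

section Freezing

variable {Ω E F : Type*} {m₀ m : MeasurableSpace Ω} [MeasurableSpace E] [MeasurableSpace F]
  {P : Measure Ω} [IsProbabilityMeasure P]

/-- Integration of a function of a known and of an independent variable. -/
lemma setLIntegral_indep (hm : m₀ ≤ m) {Z : Ω → E} {ζ : Ω → F} (hZ : Measurable[m₀] Z)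
    (hζ : Measurable ζ) (hind : Indep m₀ (MeasurableSpace.comap ζ inferInstance) P)
    {f : E → F → ENNReal} (hf : Measurable (Function.uncurry f)) {B : Set Ω}
    (hB : MeasurableSet[m₀] B) :
    ∫⁻ ω in B, f (Z ω) (ζ ω) ∂P = ∫⁻ ω in B, ∫⁻ w, f (Z ω) w ∂(P.map ζ) ∂P := by
  -- The indicator of `B` travels as an extra coordinate of the known variable, so that the integral
  -- over `B` becomes an unrestricted one to which Fubini applies.
  set Z' : Ω → E × ENNReal := fun ω => (Z ω, B.indicator 1 ω) with hZ'
  have hZ'm₀ : Measurable[m₀] Z' :=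
    hZ.prodMk (Measurable.indicator (measurable_const : Measurable[m₀] (1 : Ω → ENNReal)) hB)
  have hZ'm : Measurable Z' := hZ'm₀.mono hm le_rfl
  have hi : IndepFun Z' ζ P := by
    rw [IndepFun_iff_Indep]
    exact indep_of_indep_of_le_left hind hZ'm₀.comap_le
  have hmap := (indepFun_iff_map_prod_eq_prod_map_map hZ'm.aemeasurable hζ.aemeasurable).1 hi
  have : IsProbabilityMeasure (P.map ζ) := Measure.isProbabilityMeasure_map hζ.aemeasurable
  have hf' : Measurable fun q : (E × ENNReal) × F => q.1.2 * f q.1.1 q.2 :=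
    (measurable_snd.comp measurable_fst).mul
      (hf.comp ((measurable_fst.comp measurable_fst).prodMk measurable_snd))
  have h1 : ∫⁻ ω, (Z' ω).2 * f (Z' ω).1 (ζ ω) ∂P
      = ∫⁻ ω, ∫⁻ w, (Z' ω).2 * f (Z' ω).1 w ∂(P.map ζ) ∂P := by
    rw [← lintegral_map (f := fun q : (E × ENNReal) × F => q.1.2 * f q.1.1 q.2) hf'
      (hZ'm.prodMk hζ), hmap, lintegral_prod _ hf'.aemeasurable,
      lintegral_map hf'.lintegral_prod_right' hZ'm]
  have h2 : ∀ g : Ω → ENNReal, ∫⁻ ω in B, g ω ∂P = ∫⁻ ω, (Z' ω).2 * g ω ∂P := fun g => by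
    rw [← lintegral_indicator (hm _ hB)]
    refine lintegral_congr fun ω => ?_
    by_cases h : ω ∈ B <;> simp [hZ', h]
  rw [h2, h2, h1]
  refine lintegral_congr fun ω => ?_
  have hfz : Measurable fun w => f (Z' ω).1 w := hf.comp measurable_prodMk_left
  rw [lintegral_const_mul _ hfz]

end Freezing

/-! ### Conditional Borel–Cantelli and zero-one laws. -/

section BorelCantelli

variable {Ω : Type*} {m₀ m : MeasurableSpace Ω} {P : Measure Ω} [IsProbabilityMeasure P]

/-- Tested on the part of `G` where the conditional probability is below `p`, the integrated
hypothesis forces that part to be null. This lets all transition estimates be stated for events of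
the past, without conditional expectations. -/
lemma ae_le_condExp_indicator (hm : m₀ ≤ m) {G A : Set Ω}
    (hG : MeasurableSet[m₀] G) (hA : MeasurableSet A) {p : ℝ} (hp : 0 ≤ p)
    (h : ∀ B, MeasurableSet[m₀] B → B ⊆ G → ENNReal.ofReal p * P B ≤ P (B ∩ A)) :
    ∀ᵐ ω ∂P, ω ∈ G → p ≤ (P[A.indicator (1 : Ω → ℝ) | m₀]) ω := by
  set f := P[A.indicator (1 : Ω → ℝ) | m₀] with hf
  have hfm : Measurable[m₀] f := stronglyMeasurable_condExp.measurable
  set B := G ∩ {ω | f ω < p} with hB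
  have hBm : MeasurableSet[m₀] B := hG.inter (hfm measurableSet_Iio)
  have hint : Integrable (A.indicator (1 : Ω → ℝ)) P :=
    (integrable_const (1 : ℝ)).indicator hA
  have h1 : ∫ ω in B, f ω ∂P = P.real (B ∩ A) := by
    rw [hf, setIntegral_condExp hm hint hBm, setIntegral_indicator hA]
    simp
  have h2 : p * P.real B ≤ P.real (B ∩ A) := by
    have := ENNReal.toReal_mono (measure_ne_top _ _) (h B hBm inter_subset_left)
    rwa [ENNReal.toReal_mul, ENNReal.toReal_ofReal hp] at this
  have hfi : Integrable f P := integrable_condExp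
  have h3 : ∫ ω in B, (p - f ω) ∂P ≤ 0 := by
    rw [integral_sub (integrable_const _).integrableOn hfi.integrableOn, h1]
    simp only [integral_const, MeasurableSet.univ, measureReal_restrict_apply, univ_inter,
      smul_eq_mul]
    linarith
  have h4 : P B = 0 := by
    by_contra hne
    have hpos : 0 < ∫ ω in B, (p - f ω) ∂P := by
      rw [setIntegral_pos_iff_support_of_nonneg_ae]
      · have : Function.support (fun ω => p - f ω) ∩ B = B :=
          inter_eq_right.2 fun ω hω => (sub_pos.2 hω.2).ne'
        rw [this]
        exact pos_iff_ne_zero.2 hne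
      · filter_upwards [self_mem_ae_restrict (hm _ hBm)] with ω hω
        exact (sub_pos.2 hω.2).le
      · exact ((integrable_const _).sub hfi).integrableOn
    linarith
  filter_upwards [measure_eq_zero_iff_ae_notMem.1 h4] with ω hω hωG
  by_contra! hlt
  exact hω ⟨hωG, hlt⟩

/-- A conditional Borel–Cantelli lemma: if from each `G t` the next `H` is reached with
probability at least `p`, then infinitely many visits to `G` entail infinitely many to `H`. -/
lemma ae_frequently_of_frequently {F : Filtration ℕ m} {G H : ℕ → Set Ω}
    (hG : ∀ t, MeasurableSet[F t] (G t)) (hH : ∀ t, MeasurableSet[F t] (H t)) {p : ℝ}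
    (hp : 0 < p) (h : ∀ t B, MeasurableSet[F t] B → B ⊆ G t →
      ENNReal.ofReal p * P B ≤ P (B ∩ H (t + 1))) :
    ∀ᵐ ω ∂P, (∃ᶠ t in atTop, ω ∈ G t) → ∃ᶠ t in atTop, ω ∈ H t := by
  have h1 : ∀ᵐ ω ∂P, ∀ t, ω ∈ G t →
      p ≤ (P[(H (t + 1)).indicator (1 : Ω → ℝ) | F t]) ω :=
    ae_all_iff.2 fun t => ae_le_condExp_indicator (F.le t) (hG t) (F.le _ _ (hH _)) hp.le (h t)
  have h2 : ∀ᵐ ω ∂P, ∀ t, 0 ≤ (P[(H (t + 1)).indicator (1 : Ω → ℝ) | F t]) ω :=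
    ae_all_iff.2 fun t => condExp_nonneg (ae_of_all _ fun ω => indicator_nonneg (by simp) _)
  filter_upwards [h1, h2, ae_mem_limsup_atTop_iff P hH] with ω h1 h2 h3 hfreq
  rw [mem_limsup_iff_frequently_mem] at h3
  -- By Lévy's extension of Borel–Cantelli it suffices that the conditional probabilities have an
  -- infinite sum; they do not tend to zero, being at least `p` infinitely often.
  refine h3.2 ((not_summable_iff_tendsto_nat_atTop_of_nonneg h2).1 fun hs => ?_)
  obtain ⟨t, ht, ht'⟩ :=
    (hfreq.and_eventually (hs.tendsto_atTop_zero.eventually (gt_mem_nhds hp))).exists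
  exact absurd (h1 t ht) (not_le.2 ht')

/-- A consequence of Lévy's zero-one law: an event that has conditional probability at least `p`
infinitely often occurs. -/
lemma ae_mem_of_frequently {F : Filtration ℕ m} {G : ℕ → Set Ω} {A : Set Ω}
    (hG : ∀ t, MeasurableSet[F t] (G t)) (hA : MeasurableSet[⨆ t, F t] A) {p : ℝ}
    (hp : 0 < p) (h : ∀ t B, MeasurableSet[F t] B → B ⊆ G t →
      ENNReal.ofReal p * P B ≤ P (B ∩ A)) :
    ∀ᵐ ω ∂P, (∃ᶠ t in atTop, ω ∈ G t) → ω ∈ A := by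
  have hAm : MeasurableSet A := (iSup_le fun t => F.le t) _ hA
  have h1 : ∀ᵐ ω ∂P, ∀ t, ω ∈ G t → p ≤ (P[A.indicator (1 : Ω → ℝ) | F t]) ω :=
    ae_all_iff.2 fun t => ae_le_condExp_indicator (F.le t) (hG t) hAm hp.le (h t)
  have hint : Integrable (A.indicator (1 : Ω → ℝ)) P := (integrable_const (1 : ℝ)).indicator hAm
  have h2 := hint.tendsto_ae_condExp (ℱ := F)
    ((stronglyMeasurable_one (β := ℝ)).indicator hA)
  filter_upwards [h1, h2] with ω h1 h2 hfreq
  by_contra hω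
  rw [indicator_of_notMem hω] at h2
  obtain ⟨t, ht, ht'⟩ := (hfreq.and_eventually (h2.eventually (gt_mem_nhds hp))).exists
  exact absurd (h1 t ht) (not_le.2 ht')

end BorelCantelli

/-! ### Noise law, sigmoid and adapted chain. -/

/-- The properties of the distribution of the noise that the convergence proof uses. -/
structure IsNoiseLaw {n : ℕ} (μ : Measure (Vec n)) : Prop where
  memLp_two : MemLp id 2 μ
  mean_zero : ∫ w, w ∂μ = 0
  charges_balls : ∃ ρ : ℝ, 0 < ρ ∧ ∀ (c : Vec n) (r : ℝ), 0 < r →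
    Metric.ball c r ⊆ Metric.ball 0 ρ → 0 < μ (Metric.ball c r)

/-- Balls of a given radius with centres near the origin have mass bounded from below. -/
lemma IsNoiseLaw.exists_le_measure_ball {n : ℕ} {μ : Measure (Vec n)} [IsProbabilityMeasure μ]
    (h : IsNoiseLaw μ) : ∃ ρ : ℝ, 0 < ρ ∧ ∀ η : ℝ, 0 < η →
      ∃ p : ℝ, 0 < p ∧ ∀ c : Vec n, ‖c‖ ≤ ρ → ENNReal.ofReal p ≤ μ (Metric.ball c η) := by
  obtain ⟨ρ, hρ, hball⟩ := h.charges_balls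
  refine ⟨ρ / 2, by positivity, fun η hη => ?_⟩
  obtain ⟨p, hp, hle⟩ : ∃ p : ℝ, 0 < p ∧ ∀ c ∈ Metric.closedBall (0 : Vec n) (ρ / 2),
      ENNReal.ofReal p ≤ μ (Metric.ball c η) := by
    refine (isCompact_closedBall (0 : Vec n) (ρ / 2)).induction_on
      (p := fun s => ∃ p : ℝ, 0 < p ∧ ∀ c ∈ s, ENNReal.ofReal p ≤ μ (Metric.ball c η)) ?_ ?_ ?_ ?_
    · exact ⟨1, one_pos, by simp⟩
    · rintro s t hst ⟨p, hp, ht⟩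
      exact ⟨p, hp, fun c hc => ht c (hst hc)⟩
    · rintro s t ⟨p, hp, hs⟩ ⟨q, hq, ht⟩
      refine ⟨min p q, lt_min hp hq, ?_⟩
      rintro c (hc | hc)
      · exact (ENNReal.ofReal_le_ofReal (min_le_left _ _)).trans (hs c hc)
      · exact (ENNReal.ofReal_le_ofReal (min_le_right _ _)).trans (ht c hc)
    · intro c hc
      -- Small enough for the ball about `c` to stay inside the charged ball, and inside the
      -- `η`-ball about every centre within `η / 2` of `c`.
      set η' := min (η / 2) (ρ / 2) with hη'
      have hη'0 : 0 < η' := by positivity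
      have hpos : 0 < μ (Metric.ball c η') := by
        refine hball c η' hη'0 (Metric.ball_subset_ball' ?_)
        have h1 : dist c 0 ≤ ρ / 2 := hc
        have h2 := min_le_right (η / 2) (ρ / 2)
        linarith
      refine ⟨Metric.ball c (η / 2), mem_nhdsWithin_of_mem_nhds
        (Metric.ball_mem_nhds c (by positivity)), (μ (Metric.ball c η')).toReal,
        ENNReal.toReal_pos hpos.ne' (measure_ne_top _ _), fun c' hc' => ?_⟩
      rw [ENNReal.ofReal_toReal (measure_ne_top _ _)]
      refine measure_mono (Metric.ball_subset_ball' ?_)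
      have h1 : dist c c' < η / 2 := by rw [dist_comm]; exact hc'
      have h2 := min_le_left (η / 2) (ρ / 2)
      linarith
  exact ⟨p, hp, fun c hc => hle c (by simpa using hc)⟩

/-- The properties of the sigmoid that the convergence proof uses. -/
structure IsSigmoid (u : ℝ → ℝ) (b : ℝ) : Prop where
  monotone : Monotone u
  pos_of_pos : ∀ r, 0 < r → 0 < u r
  bound_pos : 0 < b
  abs_le : ∀ r, |u r| ≤ b

/-- The algorithm, started from an arbitrary state, as an adapted process driven by
independent noise. -/
structure KestenChain {n : ℕ} {Ω : Type*} {m : MeasurableSpace Ω} (P : Measure Ω)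
    (F : Filtration ℕ m) (μ : Measure (Vec n)) (φ : Vec n → Vec n) (γ u : ℝ → ℝ)
    (ξ x y : ℕ → Ω → Vec n) (s : ℕ → Ω → ℝ) : Prop where
  measurable_noise : ∀ t, Measurable (ξ (t + 1))
  indep : ∀ t, Indep (F t) (MeasurableSpace.comap (ξ (t + 1)) inferInstance) P
  law : ∀ t, P.map (ξ (t + 1)) = μ
  measurable_x : ∀ t, Measurable[F t] (x t)
  measurable_y : ∀ t, Measurable[F t] (y t)
  measurable_s : ∀ t, Measurable[F t] (s t)
  y_succ : ∀ t ω, y (t + 1) ω = φ (x t ω) + ξ (t + 1) ω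
  x_succ : ∀ t ω, x (t + 1) ω = x t ω - γ (s t ω) • (φ (x t ω) + ξ (t + 1) ω)
  s_succ : ∀ t ω, s (t + 1) ω = max (s t ω + u (-(inner ℝ (y (t + 1) ω) (y t ω)))) 0
  s_nonneg : ∀ t ω, 0 ≤ s t ω

/-! ### One-step estimates, and impossibility of perpetual negative drift. -/

namespace KestenChain

variable {n : ℕ} {Ω : Type*} {m : MeasurableSpace Ω} {P : Measure Ω}
  {F : Filtration ℕ m} {μ : Measure (Vec n)} {φ : Vec n → Vec n}
  {γ u : ℝ → ℝ} {b : ℝ} {ξ x y : ℕ → Ω → Vec n} {s : ℕ → Ω → ℝ}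
  {xs : Vec n} {V : Vec n → ℝ} {M : Matrix (Fin n) (Fin n) ℝ}

lemma measurable_state (hc : KestenChain P F μ φ γ u ξ x y s) (t : ℕ) :
    Measurable[F t] fun ω => (x t ω, y t ω, s t ω) :=
  (hc.measurable_x t).prodMk ((hc.measurable_y t).prodMk (hc.measurable_s t))

lemma measurableSet_potential_le (hc : KestenChain P F μ φ γ u ξ x y s) (hV : Continuous V)
    (t : ℕ) (a : ℝ) : MeasurableSet[F t] {ω | V (x t ω) ≤ a} :=
  (hV.measurable.comp (hc.measurable_x t)) measurableSet_Iic

lemma measurableSet_counter_le (hc : KestenChain P F μ φ γ u ξ x y s)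
    (t : ℕ) (a : ℝ) : MeasurableSet[F t] {ω | s t ω ≤ a} :=
  (hc.measurable_s t) measurableSet_Iic

lemma counter_succ_le (hc : KestenChain P F μ φ γ u ξ x y s) (hu : IsSigmoid u b) (t : ℕ)
    (ω : Ω) : s (t + 1) ω ≤ s t ω + b := by
  rw [hc.s_succ]
  exact max_le (by linarith [(abs_le.1 (hu.abs_le (-(inner ℝ (y (t + 1) ω) (y t ω))))).2])
    (add_nonneg (hc.s_nonneg t ω) hu.bound_pos.le)

lemma counter_add_le (hc : KestenChain P F μ φ γ u ξ x y s) (hu : IsSigmoid u b) (t k : ℕ)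
    (ω : Ω) : s (t + k) ω ≤ s t ω + b * k := by
  induction k with
  | zero => simp
  | succ k ih =>
    have := hc.counter_succ_le hu (t + k) ω
    rw [← add_assoc]; push_cast; linarith

variable [IsProbabilityMeasure P]

lemma setLIntegral_step (hc : KestenChain P F μ φ γ u ξ x y s) (t : ℕ)
    {f : Vec n × Vec n × ℝ → Vec n → ENNReal} (hf : Measurable (Function.uncurry f)) {B : Set Ω}
    (hB : MeasurableSet[F t] B) :
    ∫⁻ ω in B, f (x t ω, y t ω, s t ω) (ξ (t + 1) ω) ∂P
      = ∫⁻ ω in B, ∫⁻ w, f (x t ω, y t ω, s t ω) w ∂μ ∂P := by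
  rw [setLIntegral_indep (F.le t) (hc.measurable_state t) (hc.measurable_noise t) (hc.indep t) hf
    hB, hc.law t]

/-- Here `T` collects the pairs of state and next noise that lead to `H`. The noise is independent
of the past, so a lower bound on the mass of each section of `T` integrates to the form that the
Borel–Cantelli lemmas take. -/
lemma le_measure_inter (hc : KestenChain P F μ φ γ u ξ x y s) (t : ℕ)
    {T : Set ((Vec n × Vec n × ℝ) × Vec n)} (hT : MeasurableSet T) {B H : Set Ω}
    (hB : MeasurableSet[F t] B) {p : ENNReal}
    (hp : ∀ ω ∈ B, p ≤ μ {w | ((x t ω, y t ω, s t ω), w) ∈ T})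
    (hH : ∀ ω ∈ B, ((x t ω, y t ω, s t ω), ξ (t + 1) ω) ∈ T → ω ∈ H) :
    p * P B ≤ P (B ∩ H) := by
  set D := {ω | ((x t ω, y t ω, s t ω), ξ (t + 1) ω) ∈ T} with hD
  have hDm : MeasurableSet D :=
    (((hc.measurable_state t).mono (F.le t) le_rfl).prodMk (hc.measurable_noise t)) hT
  have hstep := hc.setLIntegral_step t (f := fun z w => T.indicator 1 (z, w))
    ((measurable_const (a := (1 : ENNReal))).indicator hT) hB
  have h1 : ∫⁻ ω in B, T.indicator 1 ((x t ω, y t ω, s t ω), ξ (t + 1) ω) ∂P = P (B ∩ D) := by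
    have : ∀ ω, T.indicator (1 : (Vec n × Vec n × ℝ) × Vec n → ENNReal) ((x t ω, y t ω, s t ω), ξ (t + 1) ω)
        = D.indicator 1 ω := fun ω => rfl
    simp_rw [this]
    rw [lintegral_indicator_one hDm, Measure.restrict_apply hDm, inter_comm]
  have h2 : p * P B ≤ ∫⁻ ω in B, ∫⁻ w, T.indicator 1 ((x t ω, y t ω, s t ω), w) ∂μ ∂P := by
    rw [← setLIntegral_const]
    refine setLIntegral_mono' (F.le t _ hB) fun ω hω => (hp ω hω).trans (le_of_eq ?_)
    exact (lintegral_indicator_one (measurable_prodMk_left hT)).symm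
  rw [← hstep, h1] at h2
  exact h2.trans (measure_mono fun ω hω => ⟨hω.1, hH ω hω.1 hω.2⟩)

variable [IsProbabilityMeasure μ]

/-- Integration of the potential after one step. -/
lemma setLIntegral_potential_succ (hc : KestenChain P F μ φ γ u ξ x y s)
    (hγ : IsStepFunction γ) (hμ : IsNoiseLaw μ)
    (h : LyapunovAssumptions φ xs (γ 0) (covMatrix μ id) V M) (t : ℕ) {B : Set Ω}
    (hB : MeasurableSet[F t] B) :
    ∫⁻ ω in B, ENNReal.ofReal (V (x (t + 1) ω)) ∂P = ∫⁻ ω in B,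
      ENNReal.ofReal (∫ w, V (x t ω - γ (s t ω) • (φ (x t ω) + w)) ∂μ) ∂P := by
  have hφ := h.continuous_field.measurable
  have hV := h.continuous_V.measurable
  have hγm := hγ.measurable
  have := hc.setLIntegral_step t (f := fun z w =>
    ENNReal.ofReal (V (z.1 - γ z.2.2 • (φ z.1 + w)))) (by unfold Function.uncurry; fun_prop) hB
  simp only at this
  simp_rw [hc.x_succ]
  rw [this]
  refine lintegral_congr fun ω => ?_
  rw [ofReal_integral_eq_lintegral_ofReal
    (h.integral_step_le hμ.memLp_two hμ.mean_zero _ _).1 (ae_of_all _ fun w => h.nonneg _)]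

/-- The potential cannot have a negative drift proportional to the step forever. -/
lemma ae_exists_not_drift (hc : KestenChain P F μ φ γ u ξ x y s)
    (hγ : IsStepFunction γ) (hμ : IsNoiseLaw μ) (hu : IsSigmoid u b)
    (h : LyapunovAssumptions φ xs (γ 0) (covMatrix μ id) V M) {c : ℝ} (hc0 : 0 < c)
    {D : Set (Vec n × ℝ)} (hD : MeasurableSet D)
    (hdrift : ∀ p ∈ D, 0 ≤ p.2 →
      ∫ w, V (p.1 - γ p.2 • (φ p.1 + w)) ∂μ ≤ V p.1 - c * γ p.2) :
    ∀ᵐ ω ∂P, ∃ᶠ t in atTop, (x t ω, s t ω) ∉ D := by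
  have key : ∀ T K : ℕ, P {ω | (V (x T ω) ≤ K ∧ s T ω ≤ K) ∧
      ∀ k, (x (T + k) ω, s (T + k) ω) ∈ D} = 0 := by
    intro T K
    set A : ℕ → Set Ω := fun k => {ω | V (x T ω) ≤ K ∧ s T ω ≤ K} ∩
      ⋂ i ∈ Finset.range k, {ω | (x (T + i) ω, s (T + i) ω) ∈ D} with hA
    -- The constraints in `A (k + 1)` involve times up to `T + k` only, so this event is known
    -- before the step from `T + k` to `T + k + 1`.
    have hAm : ∀ k, MeasurableSet[F (T + k)] (A (k + 1)) := fun k => by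
      refine MeasurableSet.inter ?_ ?_
      · exact F.mono (Nat.le_add_right T k) _
          ((hc.measurableSet_potential_le h.continuous_V T K).inter
            (hc.measurableSet_counter_le T K))
      · refine Finset.measurableSet_biInter _ fun i hi => ?_
        exact F.mono (by simp at hi; omega) _
          (((hc.measurable_x (T + i)).prodMk (hc.measurable_s (T + i))) hD)
    have hsub : ∀ k, A (k + 1) ⊆ A k := fun k ω hω => by
      refine ⟨hω.1, ?_⟩
      have h2 := hω.2
      simp only [mem_iInter, Finset.mem_range] at h2 ⊢
      exact fun i hi => h2 i (by omega)
    set q := P {ω | (V (x T ω) ≤ K ∧ s T ω ≤ K) ∧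
      ∀ k, (x (T + k) ω, s (T + k) ω) ∈ D} with hq
    have hqA : ∀ k, q ≤ P (A k) := fun k => measure_mono fun ω hω => by
      refine ⟨hω.1, ?_⟩
      simp only [mem_iInter]
      exact fun i _ => hω.2 i
    -- After `k` steps the counter is at most `K + b * k`, which bounds the step from below. Each
    -- step thus costs the potential at least `c * γ (K + b * k)` on the event of probability `q`
    -- that `D` is never left. The total cost is at most `K`, while the sum of the steps diverges,
    -- so `q = 0`.
    have hstep : ∀ k : ℕ, (∫⁻ ω in A (k + 1), ENNReal.ofReal (V (x (T + (k + 1)) ω)) ∂P)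
        + ENNReal.ofReal (c * γ (K + b * k)) * q
        ≤ ∫⁻ ω in A k, ENNReal.ofReal (V (x (T + k) ω)) ∂P := fun k => by
      have hAm' : MeasurableSet (A (k + 1)) := F.le _ _ (hAm k)
      calc _ ≤ (∫⁻ ω in A (k + 1), ENNReal.ofReal
              (∫ w, V (x (T + k) ω - γ (s (T + k) ω) • (φ (x (T + k) ω) + w)) ∂μ) ∂P)
            + ∫⁻ ω in A (k + 1), ENNReal.ofReal (c * γ (K + b * k)) ∂P := by
            rw [← hc.setLIntegral_potential_succ hγ hμ h (T + k) (hAm k), setLIntegral_const]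
            gcongr
            · rfl
            · exact hqA (k + 1)
        _ = ∫⁻ ω in A (k + 1), (ENNReal.ofReal
              (∫ w, V (x (T + k) ω - γ (s (T + k) ω) • (φ (x (T + k) ω) + w)) ∂μ)
              + ENNReal.ofReal (c * γ (K + b * k))) ∂P := by
            rw [lintegral_add_right _ measurable_const]
        _ ≤ ∫⁻ ω in A (k + 1), ENNReal.ofReal (V (x (T + k) ω)) ∂P := by
            refine setLIntegral_mono' hAm' fun ω hω => ?_
            have hmem : (x (T + k) ω, s (T + k) ω) ∈ D := by
              have h2 := hω.2
              simp only [mem_iInter, Finset.mem_range] at h2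
              exact h2 k (by omega)
            rw [← ENNReal.ofReal_add (integral_nonneg fun w => h.nonneg _)
              (mul_nonneg hc0.le (hγ.pos _).le)]
            refine ENNReal.ofReal_le_ofReal ?_
            have h1 := hdrift _ hmem (hc.s_nonneg _ _)
            have h2 : γ (K + b * k) ≤ γ (s (T + k) ω) :=
              hγ.antitone ((hc.counter_add_le hu T k ω).trans (by linarith [hω.1.2]))
            simp only at h1
            nlinarith
        _ ≤ _ := lintegral_mono_set (hsub k)
    have hsum : ∀ N : ℕ, ENNReal.ofReal (c * ∑ k ∈ Finset.range N, γ (K + b * k)) * q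
        ≤ ENNReal.ofReal K := by
      have h0 : ∀ N : ℕ, (∫⁻ ω in A N, ENNReal.ofReal (V (x (T + N) ω)) ∂P)
          + ENNReal.ofReal (c * ∑ k ∈ Finset.range N, γ (K + b * k)) * q
          ≤ ∫⁻ ω in A 0, ENNReal.ofReal (V (x T ω)) ∂P := by
        intro N
        induction N with
        | zero => simp
        | succ N ih =>
          refine le_trans ?_ ih
          rw [Finset.sum_range_succ, mul_add, ENNReal.ofReal_add
            (mul_nonneg hc0.le (Finset.sum_nonneg fun k _ => (hγ.pos _).le))
            (mul_nonneg hc0.le (hγ.pos _).le), add_mul, add_comm (_ * q) (_ * q), ← add_assoc]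
          gcongr
          exact hstep N
      intro N
      refine (le_add_self.trans (h0 N)).trans ?_
      have hA0 : MeasurableSet (A 0) := by
        simp only [hA, Finset.range_zero, Finset.notMem_empty, iInter_of_empty, iInter_univ,
          inter_univ]
        exact F.le T _ ((hc.measurableSet_potential_le h.continuous_V T K).inter
            (hc.measurableSet_counter_le T K))
      calc _ ≤ ∫⁻ ω in A 0, ENNReal.ofReal K ∂P :=
            setLIntegral_mono' hA0 fun ω hω => ENNReal.ofReal_le_ofReal hω.1.1
        _ ≤ _ := by
            rw [setLIntegral_const]
            exact mul_le_of_le_one_right' prob_le_one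
    by_contra hne
    have hq0 : 0 < q.toReal := ENNReal.toReal_pos hne (measure_ne_top _ _)
    obtain ⟨N, hN⟩ := ((hγ.tendsto_sum K b K.cast_nonneg hu.bound_pos).eventually_gt_atTop
      (K / q.toReal / c)).exists
    rw [div_lt_iff₀' hc0, div_lt_iff₀ hq0] at hN
    have h2 := ENNReal.toReal_mono ENNReal.ofReal_ne_top (hsum N)
    rw [ENNReal.toReal_mul, ENNReal.toReal_ofReal (mul_nonneg hc0.le
      (Finset.sum_nonneg fun k _ => (hγ.pos _).le)), ENNReal.toReal_ofReal K.cast_nonneg] at h2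
    linarith
  have hall : ∀ᵐ ω ∂P, ∀ T K : ℕ, ¬ ((V (x T ω) ≤ K ∧ s T ω ≤ K) ∧
      ∀ k, (x (T + k) ω, s (T + k) ω) ∈ D) :=
    ae_all_iff.2 fun T => ae_all_iff.2 fun K => measure_eq_zero_iff_ae_notMem.1 (key T K)
  filter_upwards [hall] with ω hω
  rw [frequently_atTop]
  intro T
  obtain ⟨K, hK⟩ := exists_nat_ge (max (V (x T ω)) (s T ω))
  have := hω T K
  push Not at this
  obtain ⟨k, hk⟩ := this ⟨(le_max_left _ _).trans hK, (le_max_right _ _).trans hK⟩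
  exact ⟨T + k, Nat.le_add_right _ _, hk⟩

end KestenChain

/-! ### Recurrence to small values of the potential. -/

namespace KestenChain

variable {n : ℕ} {Ω : Type*} {m : MeasurableSpace Ω} {P : Measure Ω}
  {F : Filtration ℕ m} {μ : Measure (Vec n)} {φ : Vec n → Vec n}
  {γ u : ℝ → ℝ} {b : ℝ} {ξ x y : ℕ → Ω → Vec n} {s : ℕ → Ω → ℝ}
  {xs : Vec n} {V : Vec n → ℝ} {M : Matrix (Fin n) (Fin n) ℝ}
  [IsProbabilityMeasure P] [IsProbabilityMeasure μ]

/-- Infinitely often the potential is small, or the state is in a bounded set. -/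
lemma exists_ae_frequently_bounded (hc : KestenChain P F μ φ γ u ξ x y s)
    (hγ : IsStepFunction γ) (hμ : IsNoiseLaw μ) (hu : IsSigmoid u b)
    (h : LyapunovAssumptions φ xs (γ 0) (covMatrix μ id) V M) {ε : ℝ} (hε : 0 < ε) :
    ∃ v S₀ : ℝ, 0 ≤ S₀ ∧
      ∀ᵐ ω ∂P, ∃ᶠ t in atTop, V (x t ω) ≤ ε ∨ (V (x t ω) ≤ v ∧ s t ω ≤ S₀) := by
  obtain ⟨R, β, C, hR, hβ, hC, hdrift⟩ := h.exists_drift hμ.memLp_two hμ.mean_zero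
  have hV := h.continuous_V
  have hK : IsCompact (Metric.closedBall xs R ∩ {z | ε ≤ V z}) :=
    (isCompact_closedBall xs R).inter_right (isClosed_le continuous_const hV)
  obtain ⟨d, hd, hdle⟩ := hK.exists_forall_le' h.continuous_inner_gradient.continuousOn (a := 0)
    (fun z hz => h.descent z (by rintro rfl; have := hz.2; simp [h.zero] at this; linarith))
  obtain ⟨v, hv⟩ := ((isCompact_closedBall xs R).image hV).bddAbove
  -- Half of the least truncated descent on the compact part; the other half absorbs `C * γ r ^ 2`
  -- once the counter exceeds `S₀`.
  set c := min d β / 2 with hc_def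
  have hc0 : 0 < c := by positivity
  have hev : ∀ᶠ r in atTop, C * γ r < c := by
    have := (hγ.tendsto_zero.const_mul C)
    rw [mul_zero] at this
    exact this.eventually (gt_mem_nhds hc0)
  obtain ⟨S₀, hS₀, hS₀'⟩ := (hev.and (eventually_ge_atTop 0)).exists
  refine ⟨v, S₀, hS₀', ?_⟩
  -- Leaving `D` means that the potential is at most `ε`, or that the estimate is in the ball and
  -- the counter is at most `S₀`.
  set D : Set (Vec n × ℝ) := {p | ε < V p.1 ∧ (R < ‖p.1 - xs‖ ∨ S₀ < p.2)} with hD_def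
  have hD : MeasurableSet D := by
    have o1 : IsOpen {p : Vec n × ℝ | ε < V p.1} := isOpen_lt (by fun_prop) (by fun_prop)
    have o2 : IsOpen {p : Vec n × ℝ | R < ‖p.1 - xs‖} := isOpen_lt (by fun_prop) (by fun_prop)
    have o3 : IsOpen {p : Vec n × ℝ | S₀ < p.2} := isOpen_lt (by fun_prop) (by fun_prop)
    exact (o1.inter (o2.union o3)).measurableSet
  have hDdrift : ∀ p ∈ D, 0 ≤ p.2 →
      ∫ w, V (p.1 - γ p.2 • (φ p.1 + w)) ∂μ ≤ V p.1 - c * γ p.2 := by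
    rintro ⟨z, r⟩ ⟨hz, hfar⟩ hr
    simp only at hz hfar hr ⊢
    have hg := hγ.pos r
    have hg0 : γ r ≤ γ 0 := hγ.antitone hr
    have hcβ : c ≤ β := by rw [hc_def]; linarith [min_le_right d β]
    rcases le_or_gt R ‖z - xs‖ with hx | hx
    · have := (hdrift z (γ r) hg.le hg0).1 hx
      nlinarith
    · have hr' : S₀ < r := hfar.resolve_left (not_lt.2 hx.le)
      have h1 := (hdrift z (γ r) hg.le hg0).2
      have h2 := hdle z ⟨by simpa [dist_eq_norm] using hx.le, hz.le⟩
      have h3 : 2 * c ≤ min (inner ℝ (φ z) (gradient V z)) β := by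
        rw [hc_def, mul_div_cancel₀ _ two_ne_zero]; exact min_le_min_right _ h2
      have h4 : C * γ r ≤ c :=
        (mul_le_mul_of_nonneg_left (hγ.antitone hr'.le) hC).trans hS₀.le
      nlinarith [mul_le_mul_of_nonneg_left h3 hg.le, mul_le_mul_of_nonneg_left h4 hg.le]
  filter_upwards [hc.ae_exists_not_drift hγ hμ hu h hc0 hD hDdrift] with ω hω
  refine hω.mono fun t ht => ?_
  simp only [hD_def, mem_ofPred_eq, not_and_or, not_or, not_lt] at ht
  refine ht.imp_right fun ht => ⟨hv (mem_image_of_mem _ ?_), ht.2⟩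
  simpa [dist_eq_norm] using ht.1

/-- Infinitely often the potential is small. -/
lemma ae_frequently_potential_le (hc : KestenChain P F μ φ γ u ξ x y s)
    (hγ : IsStepFunction γ) (hμ : IsNoiseLaw μ) (hu : IsSigmoid u b)
    (h : LyapunovAssumptions φ xs (γ 0) (covMatrix μ id) V M) {ε : ℝ} (hε : 0 < ε) :
    ∀ᵐ ω ∂P, ∃ᶠ t in atTop, V (x t ω) ≤ ε := by
  obtain ⟨v, S₀, hS₀, hrec⟩ := hc.exists_ae_frequently_bounded hγ hμ hu h hε
  obtain ⟨ρ, hρ, hmass⟩ := hμ.exists_le_measure_ball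
  have hV := h.continuous_V
  have htr := trace_covMatrix_mul_nonneg hμ.memLp_two hμ.mean_zero h.posDef
  have hK : IsCompact ({z | V z ≤ v} ∩ {z | ε ≤ V z}) :=
    (h.isCompact_sublevel (hγ.pos 0) htr v).inter_right (isClosed_le continuous_const hV)
  obtain ⟨c, η, hc0, hη, hstep⟩ := h.exists_ball_perturbed_step_le (hγ.pos 0) hρ hK
    (fun hz => by have := hz.2; simp [h.zero] at this; linarith)
  obtain ⟨p, hp, hple⟩ := hmass η hη
  -- The outcome of `k` favourable steps from a bounded state. The counter bound keeps the steps
  -- from below, so the guaranteed decrease is a partial sum of a divergent series.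
  set H : ℕ → ℕ → Set Ω := fun k t =>
    {ω | V (x t ω) ≤ v - c * ∑ i ∈ Finset.range k, γ (S₀ + b * i)} ∩ {ω | s t ω ≤ S₀ + b * k}
    with hH
  set G : ℕ → ℕ → Set Ω := fun k t => H k t ∩ {ω | V (x t ω) ≤ ε}ᶜ with hG
  have hHm : ∀ k t, MeasurableSet[F t] (H k t) := fun k t =>
    (hc.measurableSet_potential_le hV t _).inter (hc.measurableSet_counter_le t _)
  have hGm : ∀ k t, MeasurableSet[F t] (G k t) := fun k t =>
    (hHm k t).inter (hc.measurableSet_potential_le hV t ε).compl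
  set T : Set ((Vec n × Vec n × ℝ) × Vec n) := {q | V (q.1.1 - γ q.1.2.2 • (φ q.1.1 + q.2))
    ≤ V q.1.1 - c * γ q.1.2.2} with hT
  have hTm : MeasurableSet T := by
    have hφ := h.continuous_field.measurable
    have hVm := hV.measurable
    have hγm := hγ.measurable
    exact measurableSet_le (by fun_prop) (by fun_prop)
  have htrans : ∀ᵐ ω ∂P, ∀ k, (∃ᶠ t in atTop, ω ∈ G k t) → ∃ᶠ t in atTop, ω ∈ H (k + 1) t := by
    refine ae_all_iff.2 fun k => ae_frequently_of_frequently (hGm k) (hHm (k + 1)) hp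
      fun t B hB hBG => hc.le_measure_inter t hTm hB (fun ω hω => ?_) (fun ω hω hωT => ?_)
    · obtain ⟨⟨h1, -⟩, h3⟩ := hBG hω
      simp only [mem_compl_iff, mem_ofPred_eq, not_le] at h1 h3
      obtain ⟨w₀, hw₀, hball⟩ := hstep (x t ω) ⟨h1.trans (sub_le_self _ (mul_nonneg hc0.le
        (Finset.sum_nonneg fun i _ => (hγ.pos _).le))), h3.le⟩ (γ (s t ω)) (hγ.pos _)
        (hγ.antitone (hc.s_nonneg t ω))
      exact (hple w₀ hw₀).trans (measure_mono fun w hw => hball w hw)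
    · obtain ⟨⟨h1, h2⟩, -⟩ := hBG hω
      simp only [mem_ofPred_eq] at h1 h2
      simp only [hT, mem_ofPred_eq, ← hc.x_succ] at hωT
      refine ⟨?_, ?_⟩
      · simp only [mem_ofPred_eq, Finset.sum_range_succ]
        nlinarith [hγ.antitone h2]
      · simp only [mem_ofPred_eq]
        push_cast
        linarith [hc.counter_succ_le hu t ω]
  filter_upwards [hrec, htrans] with ω hω hω'
  -- If `V ≤ ε` ceased to occur, visits to `H k` would propagate to every `k`, and `V` would become
  -- negative.
  by_contra hcon
  rw [not_frequently] at hcon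
  have hall : ∀ k, ∃ᶠ t in atTop, ω ∈ H k t := by
    intro k
    induction k with
    | zero =>
      refine (hω.and_eventually hcon).mono fun t ht => ?_
      simpa [hH] using ht.1.resolve_left ht.2
    | succ k ih => exact hω' k ((ih.and_eventually hcon).mono fun t ht => ⟨ht.1, ht.2⟩)
  obtain ⟨k, hk⟩ := ((hγ.tendsto_sum S₀ b hS₀ hu.bound_pos).eventually_gt_atTop (v / c)).exists
  rw [div_lt_iff₀' hc0] at hk
  obtain ⟨t, ht⟩ := (hall k).exists
  have h1 : V (x t ω) ≤ _ := ht.1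
  linarith [h.nonneg (x t ω)]

end KestenChain

/-- The new point is a convex combination of `z` and `z + g • d`. This keeps an alternating run of
steps near `xs` although the steps shrink. -/
lemma norm_add_smul_sub_le {E : Type*} [NormedAddCommGroup E] [NormedSpace ℝ E] {z c d : E}
    {r g g' : ℝ} (hg : 0 < g) (hg' : 0 ≤ g') (hle : g' ≤ g) (h₀ : ‖z - c‖ ≤ r)
    (h₁ : ‖z + g • d - c‖ ≤ r) : ‖z + (g - g') • d - c‖ ≤ r := by
  have hθ : 0 ≤ g' / g := by positivity
  have hθ' : g' / g ≤ 1 := (div_le_one hg).2 hle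
  have heq : z + (g - g') • d - c
      = (g' / g) • (z - c) + (1 - g' / g) • (z + g • d - c) := by
    have : (g - g') = (1 - g' / g) * g := by field_simp
    rw [this, mul_smul]
    module
  rw [heq]
  calc _ ≤ ‖(g' / g) • (z - c)‖ + ‖(1 - g' / g) • (z + g • d - c)‖ := norm_add_le _ _
    _ = g' / g * ‖z - c‖ + (1 - g' / g) * ‖z + g • d - c‖ := by
      rw [norm_smul, norm_smul, Real.norm_of_nonneg hθ, Real.norm_of_nonneg (by linarith)]
    _ ≤ g' / g * r + (1 - g' / g) * r := by
      have : 0 ≤ 1 - g' / g := by linarith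
      gcongr
    _ = r := by ring

/-- The product is `-‖a‖ ^ 2` plus three errors, of total size at most `(1/16 + 1/4 + 1/4) * ‖a‖ ^
2`. -/
lemma inner_le_of_near_opposite {E : Type*} [NormedAddCommGroup E] [InnerProductSpace ℝ E]
    {a v w : E} {η : ℝ} (hη : η ≤ ‖a‖ / 4) (hv : ‖v - a‖ ≤ η) (hw : ‖w + a‖ ≤ η) :
    inner ℝ w v ≤ -(‖a‖ ^ 2 / 4) := by
  have h1 : inner ℝ w v = inner ℝ (w + a) (v - a) + inner ℝ (w + a) a - inner ℝ a (v - a)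
      - ‖a‖ ^ 2 := by
    rw [← real_inner_self_eq_norm_sq]
    simp only [inner_add_left, inner_sub_right]
    ring
  have h2 := (real_inner_le_norm (w + a) (v - a))
  have h3 := (real_inner_le_norm (w + a) a)
  have h4 := (abs_le.1 (abs_real_inner_le_norm a (v - a))).1
  have h0 := norm_nonneg (w + a)
  have h0' := norm_nonneg (v - a)
  have ha := norm_nonneg a
  have h5 : ‖w + a‖ * ‖v - a‖ ≤ ‖a‖ / 4 * (‖a‖ / 4) := by gcongr <;> linarith
  have h6 : ‖w + a‖ * ‖a‖ ≤ ‖a‖ / 4 * ‖a‖ := by gcongr; linarith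
  have h7 : ‖a‖ * ‖v - a‖ ≤ ‖a‖ * (‖a‖ / 4) := by gcongr; linarith
  nlinarith

/-! ### Raising the counter by alternating measurements near the stationary point. -/

namespace KestenChain

variable {n : ℕ} {Ω : Type*} {m : MeasurableSpace Ω} {P : Measure Ω}
  {F : Filtration ℕ m} {μ : Measure (Vec n)} {φ : Vec n → Vec n}
  {γ u : ℝ → ℝ} {b : ℝ} {ξ x y : ℕ → Ω → Vec n} {s : ℕ → Ω → ℝ}
  {xs : Vec n} {V : Vec n → ℝ} {M : Matrix (Fin n) (Fin n) ℝ}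
  [IsProbabilityMeasure P] [IsProbabilityMeasure μ]

/-- Infinitely often the estimate is near the stationary point while the counter is large. -/
lemma ae_frequently_near_and_counter_ge [Nontrivial (Vec n)]
    (hc : KestenChain P F μ φ γ u ξ x y s)
    (hγ : IsStepFunction γ) (hμ : IsNoiseLaw μ) (hu : IsSigmoid u b)
    (h : LyapunovAssumptions φ xs (γ 0) (covMatrix μ id) V M) {r : ℝ} (hr : 0 < r) (S₁ : ℝ) :
    ∀ᵐ ω ∂P, ∃ᶠ t in atTop, ‖x t ω - xs‖ ≤ r ∧ S₁ ≤ s t ω := by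
  obtain ⟨ρ, hρ, hmass⟩ := hμ.exists_le_measure_ball
  have htr := trace_covMatrix_mul_nonneg hμ.memLp_two hμ.mean_zero h.posDef
  have hγ0 := hγ.pos 0
  obtain ⟨r₁, hr₁, hφr⟩ : ∃ r₁ > 0, ∀ z, ‖z - xs‖ < r₁ → ‖φ z‖ ≤ ρ / 2 := by
    obtain ⟨r₁, hr₁, hball⟩ := Metric.continuousAt_iff.1 h.continuous_field.continuousAt
      (ρ / 2) (by positivity)
    refine ⟨r₁, hr₁, fun z hz => ?_⟩
    have := hball (x := z) (by simpa [dist_eq_norm] using hz)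
    rw [h.stationary, dist_zero_right] at this
    exact this.le
  set r₀ := min r r₁ with hr₀
  have hr₀0 : 0 < r₀ := lt_min hr hr₁
  -- The first bound keeps the noise needed for a measurement near `±a` within `ρ`, as the field is
  -- at most `ρ / 2`; the second makes the displacements at the start of the run fit into `r₀ / 4`.
  set α := min (ρ / 2) (r₀ / (12 * γ 0)) with hα
  have hα0 : 0 < α := by positivity
  have hαρ : α ≤ ρ / 2 := min_le_left _ _
  have hαr : γ 0 * (3 * α) ≤ r₀ / 4 := by
    have h1 : α ≤ r₀ / (12 * γ 0) := min_le_right _ _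
    rw [le_div_iff₀ (by positivity)] at h1
    linarith
  obtain ⟨a, ha⟩ := exists_norm_eq (Vec n) hα0.le
  set κ := u (α ^ 2 / 4) with hκ
  have hκ0 : 0 < κ := hu.pos_of_pos _ (by positivity)
  -- The length of the run: each negative product raises the counter by at least `κ`.
  obtain ⟨K, hK⟩ := exists_nat_ge (S₁ / κ)
  rw [div_le_iff₀ hκ0] at hK
  -- Precise enough for consecutive measurements to be nearly opposite, and for the errors of `K`
  -- steps to add up to at most `r₀ / 4`.
  set η := min (α / 4) (r₀ / (4 * (K + 1) * γ 0)) with hη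
  have hη0 : 0 < η := by positivity
  have hηα : η ≤ α / 4 := min_le_left _ _
  have hηK : ∀ k : ℕ, k ≤ K → k * (γ 0 * η) ≤ r₀ / 4 := fun k hk => by
    have h1 : η ≤ r₀ / (4 * (K + 1) * γ 0) := min_le_right _ _
    rw [le_div_iff₀ (by positivity)] at h1
    have h2 : (k : ℝ) ≤ K + 1 := by exact_mod_cast hk.trans (Nat.le_succ K)
    have h3 : k * (γ 0 * η) ≤ (K + 1) * (γ 0 * η) := by gcongr
    linarith
  obtain ⟨p, hp, hple⟩ := hmass η hη0
  obtain ⟨ε, hε, hεsub⟩ := h.exists_sublevel_subset_ball hγ0 htr (r := r₀ / 4) (by positivity)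
  set σ : ℕ → Vec n := fun k => (-1 : ℝ) ^ k • a with hσ
  have hσn : ∀ k, ‖σ k‖ = α := fun k => by simp [hσ, norm_smul, ha]
  have hσs : ∀ k, σ (k + 1) = -σ k := fun k => by simp [hσ, pow_succ]
  -- Besides the estimate, the set controls `x + γ(s) σ_k`, the point to which an exact next
  -- measurement `-σ_k` would lead. Carrying both points makes the induction close, with an
  -- additional error of only `γ 0 * η` per step.
  set H : ℕ → ℕ → Set Ω := fun k t => {ω | ‖y t ω - σ k‖ ≤ η ∧
    ‖x t ω - xs‖ ≤ r₀ / 2 + k * (γ 0 * η) ∧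
    ‖x t ω + γ (s t ω) • σ k - xs‖ ≤ r₀ / 2 + k * (γ 0 * η) ∧ κ * k ≤ s t ω} with hH
  have hHm : ∀ k t, MeasurableSet[F t] (H k t) := fun k t => by
    have hγm := hγ.measurable
    have : MeasurableSet {q : Vec n × Vec n × ℝ | ‖q.2.1 - σ k‖ ≤ η ∧
        ‖q.1 - xs‖ ≤ r₀ / 2 + k * (γ 0 * η) ∧
        ‖q.1 + γ q.2.2 • σ k - xs‖ ≤ r₀ / 2 + k * (γ 0 * η) ∧ κ * k ≤ q.2.2} := by
      have hle : ∀ f g : Vec n × Vec n × ℝ → ℝ, Measurable f → Measurable g →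
          MeasurableSet {q | f q ≤ g q} := fun f g hf hg => measurableSet_le hf hg
      exact (hle (fun q => ‖q.2.1 - σ k‖) (fun _ => η) (by fun_prop) (by fun_prop)).inter
        ((hle (fun q => ‖q.1 - xs‖) (fun _ => _) (by fun_prop) (by fun_prop)).inter
        ((hle (fun q => ‖q.1 + γ q.2.2 • σ k - xs‖) (fun _ => _) (by fun_prop)
          (by fun_prop)).inter
        (hle (fun _ => κ * k) (fun q => q.2.2) (by fun_prop) (by fun_prop))))
    exact (hc.measurable_state t) this
  have hTm : ∀ k, MeasurableSet {q : (Vec n × Vec n × ℝ) × Vec n |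
      ‖φ q.1.1 + q.2 - σ k‖ ≤ η} := fun k => by
    have hφ := h.continuous_field.measurable
    exact measurableSet_le (by fun_prop) (by fun_prop)
  have hmassT : ∀ k z, ‖z - xs‖ < r₁ → ENNReal.ofReal p ≤ μ {w | ‖φ z + w - σ k‖ ≤ η} :=
    fun k z hz => by
      refine (hple (σ k - φ z) ?_).trans (measure_mono fun w hw => ?_)
      · exact (norm_sub_le _ _).trans (by linarith [hσn k, hφr z hz])
      · rw [Metric.mem_ball, dist_eq_norm] at hw
        have heq : φ z + w - σ k = w - (σ k - φ z) := by abel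
        rw [mem_ofPred_eq, heq]
        exact hw.le
  have hr₀₁ : r₀ ≤ r₁ := min_le_right _ _
  -- The budget at the start is `r₀ / 4` for the sublevel set, `2 * α * γ 0` for the step just made
  -- and `α * γ 0` for the anticipated one.
  have hstart : ∀ᵐ ω ∂P, (∃ᶠ t in atTop, ω ∈ {ω | V (x t ω) ≤ ε}) →
      ∃ᶠ t in atTop, ω ∈ H 0 t := by
    refine ae_frequently_of_frequently
      (fun t => hc.measurableSet_potential_le h.continuous_V t ε) (hHm 0) hp
      fun t B hB hBG => hc.le_measure_inter t (hTm 0) hB (fun ω hω => ?_) (fun ω hω hωT => ?_)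
    · exact hmassT 0 _ ((hεsub _ (hBG hω)).trans (by linarith))
    · have h1 := hεsub _ (hBG hω)
      have hg := hγ.pos (s t ω)
      have hg0 := hγ.antitone (hc.s_nonneg t ω)
      have hg' := hγ.pos (s (t + 1) ω)
      have hg0' := hγ.antitone (hc.s_nonneg (t + 1) ω)
      rw [mem_ofPred_eq, ← hc.y_succ] at hωT
      have hyn : ‖y (t + 1) ω‖ ≤ 2 * α := by
        have := norm_le_norm_add_norm_sub' (y (t + 1) ω) (σ 0)
        linarith [hσn 0]
      have h2 : ‖γ (s t ω) • y (t + 1) ω‖ ≤ γ 0 * (2 * α) := by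
        rw [norm_smul, Real.norm_of_nonneg hg.le]; gcongr
      have h3 : ‖γ (s (t + 1) ω) • σ 0‖ ≤ γ 0 * α := by
        rw [norm_smul, Real.norm_of_nonneg hg'.le, hσn]; gcongr
      have hx : x (t + 1) ω = x t ω - γ (s t ω) • y (t + 1) ω := by
        rw [hc.x_succ, hc.y_succ]
      have h4 : ‖x (t + 1) ω - xs‖ ≤ r₀ / 4 + γ 0 * (2 * α) := by
        have heq : x (t + 1) ω - xs = (x t ω - xs) - γ (s t ω) • y (t + 1) ω := by
          rw [hx]; abel
        rw [heq]
        exact (norm_sub_le _ _).trans (add_le_add h1.le h2)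
      refine ⟨hωT, ?_, ?_, by simpa using hc.s_nonneg (t + 1) ω⟩
      · have : 0 ≤ γ 0 * α := by positivity
        simp only [Nat.cast_zero, zero_mul, add_zero]
        linarith
      · have heq : x (t + 1) ω + γ (s (t + 1) ω) • σ 0 - xs
            = (x (t + 1) ω - xs) + γ (s (t + 1) ω) • σ 0 := by abel
        rw [heq]
        refine (norm_add_le _ _).trans ?_
        simp only [Nat.cast_zero, zero_mul, add_zero]
        linarith
  have htrans : ∀ᵐ ω ∂P, ∀ k, k < K → (∃ᶠ t in atTop, ω ∈ H k t) →
      ∃ᶠ t in atTop, ω ∈ H (k + 1) t := by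
    refine ae_all_iff.2 fun k => ?_
    by_cases hk : k < K
    swap
    · exact ae_of_all _ fun ω h => absurd h hk
    refine (ae_frequently_of_frequently (hHm k) (hHm (k + 1)) hp
      fun t B hB hBG => hc.le_measure_inter t (hTm (k + 1)) hB (fun ω hω => ?_)
        (fun ω hω hωT => ?_)).mono fun ω hω _ => hω
    · obtain ⟨-, h2, -⟩ := hBG hω
      exact hmassT (k + 1) _ (by linarith [hηK k hk.le])
    · obtain ⟨h1, h2, h3, h4⟩ := hBG hω
      rw [mem_ofPred_eq, ← hc.y_succ] at hωT
      simp only [hσs, sub_neg_eq_add] at hωT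
      have hg := hγ.pos (s t ω)
      have hg0 := hγ.antitone (hc.s_nonneg t ω)
      have hinner := inner_le_of_near_opposite (hηα.trans_eq (by rw [hσn])) h1 hωT
      rw [hσn] at hinner
      have hs : s t ω + κ ≤ s (t + 1) ω := by
        rw [hc.s_succ]
        exact (add_le_add_right (hu.monotone (by linarith)) _).trans (le_max_left _ _)
      have herr : ‖γ (s t ω) • (y (t + 1) ω + σ k)‖ ≤ γ 0 * η := by
        rw [norm_smul, Real.norm_of_nonneg hg.le]; gcongr
      have hx : x (t + 1) ω
          = x t ω + γ (s t ω) • σ k - γ (s t ω) • (y (t + 1) ω + σ k) := by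
        rw [hc.x_succ, hc.y_succ]; module
      refine ⟨by simpa only [hσs, sub_neg_eq_add] using hωT, ?_, ?_, ?_⟩
      · have heq : x (t + 1) ω - xs = (x t ω + γ (s t ω) • σ k - xs)
            - γ (s t ω) • (y (t + 1) ω + σ k) := by rw [hx]; abel
        rw [heq]
        refine (norm_sub_le _ _).trans ?_
        push_cast
        linarith
      -- Up to the error, the next anticipated point lies between the old estimate and the old
      -- anticipated point, because the counter has grown and the step has not.
      · have h5 := norm_add_smul_sub_le hg (hγ.pos (s (t + 1) ω)).le
          (hγ.antitone (by linarith : s t ω ≤ s (t + 1) ω)) h2 h3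
        have heq : x (t + 1) ω + γ (s (t + 1) ω) • σ (k + 1) - xs
            = (x t ω + (γ (s t ω) - γ (s (t + 1) ω)) • σ k - xs)
            - γ (s t ω) • (y (t + 1) ω + σ k) := by rw [hx, hσs]; module
        rw [heq]
        refine (norm_sub_le _ _).trans ?_
        push_cast
        linarith
      · push_cast
        linarith
  filter_upwards [hc.ae_frequently_potential_le hγ hμ hu h hε, hstart, htrans] with ω h1 h2 h3
  have hall : ∀ k, k ≤ K → ∃ᶠ t in atTop, ω ∈ H k t := by
    intro k
    induction k with
    | zero => exact fun _ => h2 h1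
    | succ k ih => exact fun hk => h3 k hk (ih (by omega))
  refine (hall K le_rfl).mono fun t ⟨_, h5, _, h6⟩ => ⟨?_, ?_⟩
  · linarith [hηK K le_rfl, min_le_left r r₁]
  · linarith

end KestenChain

/-- For `|z| ≤ 1` one has `exp (-z) ≤ 1 - z + z ^ 2`. The smallness of `l` lets half of the mean
gain absorb the quadratic term, and `1 - z ≤ exp (-z)` turns the result back into an exponential. -/
lemma integral_exp_neg_le {α : Type*} [MeasurableSpace α] {μ : Measure α} [IsProbabilityMeasure μ]
    {f : α → ℝ} (hf : Measurable f) {D κ l : ℝ} (hfD : ∀ w, |f w| ≤ D)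
    (hκ : κ ≤ ∫ w, f w ∂μ) (hl : 0 ≤ l) (hlD : l * D ≤ 1) (hlκ : l * D ^ 2 ≤ κ / 2) :
    ∫ w, Real.exp (-(l * f w)) ∂μ ≤ Real.exp (-(l * (κ / 2))) := by
  have hfi : Integrable f μ :=
    Integrable.of_bound hf.aestronglyMeasurable D (ae_of_all _ hfD)
  have hle : ∀ w, Real.exp (-(l * f w)) ≤ 1 + l ^ 2 * D ^ 2 - l * f w := fun w => by
    have habs : |-(l * f w)| ≤ l * D := by
      rw [abs_neg, abs_mul, abs_of_nonneg hl]; gcongr; exact hfD w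
    have h1 := (abs_le.1 (Real.abs_exp_sub_one_sub_id_le (habs.trans hlD))).2
    have h2 : (-(l * f w)) ^ 2 ≤ (l * D) ^ 2 := sq_le_sq' (by
      linarith [(abs_le.1 habs).1]) (abs_le.1 habs).2
    nlinarith
  have hi : Integrable (fun w => 1 + l ^ 2 * D ^ 2 - l * f w) μ :=
    (integrable_const _).sub (hfi.const_mul l)
  have hexp : Integrable (fun w => Real.exp (-(l * f w))) μ :=
    hi.mono' (by fun_prop) (ae_of_all _ fun w => by
      rw [Real.norm_of_nonneg (Real.exp_pos _).le]; exact hle w)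
  refine (integral_mono hexp hi hle).trans ?_
  rw [integral_sub (integrable_const _) (hfi.const_mul l), integral_const_mul, integral_const]
  simp only [probReal_univ, smul_eq_mul, one_mul]
  have h1 := Real.add_one_le_exp (-(l * (κ / 2)))
  nlinarith [mul_le_mul_of_nonneg_left hκ hl, mul_le_mul_of_nonneg_left hlκ hl]

lemma summable_iff_tsum_ofReal_ne_top {f : ℕ → ℝ} (hf : ∀ k, 0 ≤ f k) :
    Summable f ↔ ∑' k, ENNReal.ofReal (f k) ≠ ⊤ := by
  refine ⟨fun h => h.tsum_ofReal_ne_top, fun h => ?_⟩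
  have := ENNReal.summable_toReal h
  simpa only [ENNReal.toReal_ofReal (hf _)] using this

lemma measurableSet_summable {α : Type*} {_ : MeasurableSpace α} {f : ℕ → α → ℝ}
    (hf : ∀ k, Measurable (f k)) (hf0 : ∀ k a, 0 ≤ f k a) :
    MeasurableSet {a | Summable fun k => f k a} := by
  simp_rw [summable_iff_tsum_ofReal_ne_top fun k => hf0 k _]
  exact (Measurable.tsum fun k => (hf k).ennreal_ofReal) (measurableSet_singleton ⊤).compl

/-! ### Exponential drift of the corrected counter. -/

section CounterGain

variable {n : ℕ} {μ : Measure (Vec n)} [IsProbabilityMeasure μ] {u : ℝ → ℝ} {b : ℝ}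

/-- A lower bound for the mean increment of the counter after a measurement `v`, as long as the
field does not exceed `r`. -/
noncomputable def counterGain (μ : Measure (Vec n)) (u : ℝ → ℝ) (r : ℝ) (v : Vec n) : ℝ :=
  ∫ w, u (-(inner ℝ w v) - r * ‖v‖) ∂μ

lemma IsSigmoid.measurable (hu : IsSigmoid u b) : Measurable u := hu.monotone.measurable

lemma measurable_counterGain (hu : IsSigmoid u b) (r : ℝ) : Measurable (counterGain μ u r) := by
  have hum := hu.measurable
  have : Measurable fun q : Vec n × Vec n => u (-(inner ℝ q.2 q.1) - r * ‖q.1‖) := by fun_prop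
  exact this.stronglyMeasurable.integral_prod_right'.measurable

lemma abs_counterGain_le (hu : IsSigmoid u b) (r : ℝ) (v : Vec n) :
    |counterGain μ u r v| ≤ b := by
  have := norm_integral_le_of_norm_le_const (μ := μ) (C := b)
    (f := fun w => u (-(inner ℝ w v) - r * ‖v‖)) (ae_of_all _ fun w => hu.abs_le _)
  simpa [counterGain] using this

/-- The counter, compensated by its expected gain, has an exponential supermartingale. -/
lemma exists_exp_drift (hu : IsSigmoid u b) {r κ : ℝ} (hκ0 : 0 < κ)
    (hκ : ∀ p : Vec n, ‖p‖ ≤ r → κ ≤ ∫ w, counterGain μ u r (p + w) ∂μ) :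
    ∃ l : ℝ, 0 < l ∧ ∀ p : Vec n, ‖p‖ ≤ r → ∀ (v : Vec n) (c : ℝ),
      ∫⁻ w, ENNReal.ofReal (Real.exp (-(l * (max (c + u (-(inner ℝ (p + w) v))) 0
        + counterGain μ u r (p + w))))) ∂μ
      ≤ ENNReal.ofReal (Real.exp (-(l * (κ / 2)))) *
        ENNReal.ofReal (Real.exp (-(l * (c + counterGain μ u r v)))) := by
  have hb := hu.bound_pos
  -- The two bounds are the smallness conditions of `integral_exp_neg_le` for increments bounded by
  -- `3 * b`.
  set l := min (1 / (3 * b)) (κ / 2 / (3 * b) ^ 2) with hl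
  have hl0 : 0 < l := by positivity
  have hl1 : l * (3 * b) ≤ 1 := by
    rw [← le_div_iff₀ (by positivity)]; exact min_le_left _ _
  have hl2 : l * (3 * b) ^ 2 ≤ κ / 2 := by
    rw [← le_div_iff₀ (by positivity)]; exact min_le_right _ _
  refine ⟨l, hl0, fun p hp v c => ?_⟩
  have hum := hu.measurable
  have hgm := measurable_counterGain (μ := μ) hu r
  -- A lower bound for the increment of the corrected counter. The gain after a given `v` may be
  -- negative, but it is the mean of the first term and cancels against the last one. What remains
  -- is the gain averaged over the next measurement, which is at least `κ`.
  set f : Vec n → ℝ := fun w => u (-(inner ℝ w v) - r * ‖v‖) + counterGain μ u r (p + w)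
    - counterGain μ u r v with hf
  have hfm : Measurable f := by fun_prop
  have hfb : ∀ w, |f w| ≤ 3 * b := fun w => by
    have h1 := abs_le.1 (hu.abs_le (-(inner ℝ w v) - r * ‖v‖))
    have h2 := abs_le.1 (abs_counterGain_le (μ := μ) hu r (p + w))
    have h3 := abs_le.1 (abs_counterGain_le (μ := μ) hu r v)
    rw [abs_le]
    constructor <;> simp only [hf] <;> linarith
  have hfκ : κ ≤ ∫ w, f w ∂μ := by
    have i1 : Integrable (fun w => u (-(inner ℝ w v) - r * ‖v‖)) μ :=
      Integrable.of_bound (Measurable.aestronglyMeasurable (by fun_prop)) b (ae_of_all _ fun w => hu.abs_le _)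
    have i2 : Integrable (fun w => counterGain μ u r (p + w)) μ :=
      Integrable.of_bound (Measurable.aestronglyMeasurable (by fun_prop)) b (ae_of_all _ fun w => abs_counterGain_le hu r _)
    have : ∫ w, f w ∂μ = counterGain μ u r v + (∫ w, counterGain μ u r (p + w) ∂μ)
        - counterGain μ u r v := by
      simp only [hf]
      rw [integral_sub (by exact i1.add i2) (integrable_const _), integral_add i1 i2]
      simp [counterGain]
    rw [this]
    linarith [hκ p hp]
  have hpt : ∀ w, Real.exp (-(l * (max (c + u (-(inner ℝ (p + w) v))) 0
      + counterGain μ u r (p + w))))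
      ≤ Real.exp (-(l * (c + counterGain μ u r v))) * Real.exp (-(l * f w)) := fun w => by
    rw [← Real.exp_add]
    refine Real.exp_le_exp.2 ?_
    have h1 : u (-(inner ℝ w v) - r * ‖v‖) ≤ u (-(inner ℝ (p + w) v)) := by
      refine hu.monotone ?_
      have h2 := real_inner_le_norm p v
      have h3 := mul_le_mul_of_nonneg_right hp (norm_nonneg v)
      rw [inner_add_left]
      linarith
    have h4 := le_max_left (c + u (-(inner ℝ (p + w) v))) 0
    simp only [hf]
    nlinarith
  have hint : Integrable (fun w => Real.exp (-(l * f w))) μ :=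
    Integrable.of_bound (by fun_prop) (Real.exp 1) (ae_of_all _ fun w => by
      rw [Real.norm_of_nonneg (Real.exp_pos _).le]
      refine Real.exp_le_exp.2 ?_
      have := (abs_le.1 (hfb w)).1
      nlinarith)
  calc _ ≤ ∫⁻ w, ENNReal.ofReal (Real.exp (-(l * (c + counterGain μ u r v)))) *
        ENNReal.ofReal (Real.exp (-(l * f w))) ∂μ := by
        refine lintegral_mono fun w => ?_
        rw [← ENNReal.ofReal_mul (Real.exp_pos _).le]
        exact ENNReal.ofReal_le_ofReal (hpt w)
    _ = ENNReal.ofReal (Real.exp (-(l * (c + counterGain μ u r v)))) *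
        ENNReal.ofReal (∫ w, Real.exp (-(l * f w)) ∂μ) := by
        rw [lintegral_const_mul _ (by fun_prop), ofReal_integral_eq_lintegral_ofReal hint
          (ae_of_all _ fun w => (Real.exp_pos _).le)]
    _ ≤ _ := by
        rw [mul_comm]
        gcongr
        exact integral_exp_neg_le hfm hfb hfκ hl0.le hl1 hl2

end CounterGain

/-! ### Growth of the potential in terms of the squared steps. -/

namespace KestenChain

variable {n : ℕ} {Ω : Type*} {m : MeasurableSpace Ω} {P : Measure Ω}
  {F : Filtration ℕ m} {μ : Measure (Vec n)} {φ : Vec n → Vec n}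
  {γ u : ℝ → ℝ} {b : ℝ} {ξ x y : ℕ → Ω → Vec n} {s : ℕ → Ω → ℝ}
  {xs : Vec n} {V : Vec n → ℝ} {M : Matrix (Fin n) (Fin n) ℝ}

lemma measurableSet_summable_sq (hc : KestenChain P F μ φ γ u ξ x y s) (hγ : IsStepFunction γ) :
    MeasurableSet[⨆ t, F t] {ω | Summable fun t => γ (s t ω) ^ 2} := by
  exact measurableSet_summable (fun t => ((hγ.measurable.pow_const 2).comp
    (hc.measurable_s t)).mono (le_iSup F.seq t) le_rfl) fun t ω => sq_nonneg _

variable [IsProbabilityMeasure P] [IsProbabilityMeasure μ]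

/-- The potential grows at most by the squared steps. -/
lemma exists_setLIntegral_potential_succ_le (hc : KestenChain P F μ φ γ u ξ x y s)
    (hγ : IsStepFunction γ) (hμ : IsNoiseLaw μ)
    (h : LyapunovAssumptions φ xs (γ 0) (covMatrix μ id) V M) :
    ∃ C : ℝ, 0 ≤ C ∧ ∀ t B, MeasurableSet[F t] B →
      ∫⁻ ω in B, ENNReal.ofReal (V (x (t + 1) ω)) ∂P
        ≤ (∫⁻ ω in B, ENNReal.ofReal (V (x t ω)) ∂P)
          + ENNReal.ofReal C * ∫⁻ ω in B, ENNReal.ofReal (γ (s t ω) ^ 2) ∂P := by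
  obtain ⟨R, β, C, -, hβ, hC, hdrift⟩ := h.exists_drift hμ.memLp_two hμ.mean_zero
  refine ⟨C, hC, fun t B hB => ?_⟩
  have hVm : Measurable fun ω => ENNReal.ofReal (V (x t ω)) :=
    (h.continuous_V.measurable.comp ((hc.measurable_x t).mono (F.le t) le_rfl)).ennreal_ofReal
  rw [hc.setLIntegral_potential_succ hγ hμ h t hB, ← lintegral_const_mul' _ _ ENNReal.ofReal_ne_top,
    ← lintegral_add_left hVm]
  refine setLIntegral_mono' (F.le t _ hB) fun ω _ => ?_
  rw [← ENNReal.ofReal_mul hC, ← ENNReal.ofReal_add (h.nonneg _) (by positivity)]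
  refine ENNReal.ofReal_le_ofReal ?_
  have hg := hγ.pos (s t ω)
  have h1 := (hdrift (x t ω) _ hg.le (hγ.antitone (hc.s_nonneg t ω))).2
  have h2 : 0 ≤ min (inner ℝ (φ (x t ω)) (gradient V (x t ω))) β := by
    refine le_min ?_ hβ.le
    by_cases hx : x t ω = xs
    · simp [hx, h.stationary]
    · exact (h.descent _ hx).le
  nlinarith [mul_nonneg hg.le h2]

end KestenChain

/-! ### Square summability of the steps with probability at least one half. -/

namespace KestenChain

variable {n : ℕ} {Ω : Type*} {m : MeasurableSpace Ω} {P : Measure Ω}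
  {F : Filtration ℕ m} {μ : Measure (Vec n)} {φ : Vec n → Vec n}
  {γ u : ℝ → ℝ} {b : ℝ} {ξ x y : ℕ → Ω → Vec n} {s : ℕ → Ω → ℝ}
  {xs : Vec n} {V : Vec n → ℝ} {M : Matrix (Fin n) (Fin n) ℝ}

/-- The event that a sublevel set is not left during `k` steps from `T` on. -/
def staySet (V : Vec n → ℝ) (x : ℕ → Ω → Vec n) (ε : ℝ) (T : ℕ) (B : Set Ω) (k : ℕ) : Set Ω :=
  B ∩ ⋂ i ∈ Finset.range k, {ω | V (x (T + (i + 1)) ω) ≤ ε}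

lemma staySet_succ (V : Vec n → ℝ) (x : ℕ → Ω → Vec n) (ε : ℝ) (T : ℕ) (B : Set Ω) (k : ℕ) :
    staySet V x ε T B (k + 1) = staySet V x ε T B k ∩ {ω | V (x (T + (k + 1)) ω) ≤ ε} := by
  simp only [staySet, Finset.range_add_one, Finset.set_biInter_insert]
  ext ω
  simp only [mem_inter_iff]
  tauto

lemma staySet_zero (V : Vec n → ℝ) (x : ℕ → Ω → Vec n) (ε : ℝ) (T : ℕ) (B : Set Ω) :
    staySet V x ε T B 0 = B := by simp [staySet]

lemma antitone_staySet (V : Vec n → ℝ) (x : ℕ → Ω → Vec n) (ε : ℝ) (T : ℕ) (B : Set Ω) :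
    Antitone (staySet V x ε T B) :=
  antitone_nat_of_succ_le fun k => by rw [staySet_succ]; exact inter_subset_left

lemma potential_le_of_mem_staySet {ε : ℝ} {T : ℕ} {B : Set Ω} (hB : ∀ ω ∈ B, V (x T ω) ≤ ε)
    {k : ℕ} {ω : Ω} (hω : ω ∈ staySet V x ε T B k) : V (x (T + k) ω) ≤ ε := by
  cases k with
  | zero => exact hB ω hω.1
  | succ k => rw [staySet_succ] at hω; exact hω.2

lemma measurableSet_staySet (hc : KestenChain P F μ φ γ u ξ x y s) (hV : Continuous V) (ε : ℝ)
    {T : ℕ} {B : Set Ω} (hB : MeasurableSet[F T] B) (k : ℕ) :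
    MeasurableSet[F (T + k)] (staySet V x ε T B k) := by
  induction k with
  | zero => rw [staySet_zero]; exact hB
  | succ k ih =>
    rw [staySet_succ]
    exact (F.mono (Nat.le_succ _) _ ih).inter (hc.measurableSet_potential_le hV _ _)

variable [IsProbabilityMeasure P] [IsProbabilityMeasure μ]

/-- The exponential moments of the counter decay geometrically while a sublevel set on which the
field is small is not left. -/
lemma setLIntegral_exp_staySet_le (hc : KestenChain P F μ φ γ u ξ x y s)
    (hu : IsSigmoid u b) (hφ : Continuous φ) (hV : Continuous V) {r l κ ε : ℝ}
    (hdrift : ∀ p : Vec n, ‖p‖ ≤ r → ∀ (v : Vec n) (c : ℝ),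
      ∫⁻ w, ENNReal.ofReal (Real.exp (-(l * (max (c + u (-(inner ℝ (p + w) v))) 0
        + counterGain μ u r (p + w))))) ∂μ
      ≤ ENNReal.ofReal (Real.exp (-(l * (κ / 2)))) *
        ENNReal.ofReal (Real.exp (-(l * (c + counterGain μ u r v)))))
    (hl : 0 < l) (hε : ∀ z, V z ≤ ε → ‖φ z‖ ≤ r) {T : ℕ} {B : Set Ω}
    (hB : MeasurableSet[F T] B) (hBV : ∀ ω ∈ B, V (x T ω) ≤ ε) {S₁ : ℝ}
    (hBs : ∀ ω ∈ B, S₁ ≤ s T ω) (k : ℕ) :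
    ∫⁻ ω in staySet V x ε T B k, ENNReal.ofReal (Real.exp (-(l * (s (T + k) ω
        + counterGain μ u r (y (T + k) ω))))) ∂P
      ≤ ENNReal.ofReal (Real.exp (-(l * (κ / 2) * k) - l * (S₁ - b))) * P B := by
  have hum := hu.measurable
  have hgm := measurable_counterGain (μ := μ) hu r
  have hφm := hφ.measurable
  induction k with
  | zero =>
    rw [staySet_zero, ← setLIntegral_const]
    refine setLIntegral_mono' (F.le T _ hB) fun ω hω => ENNReal.ofReal_le_ofReal
      (Real.exp_le_exp.2 ?_)
    have h1 := hBs ω hω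
    have h2 := (abs_le.1 (abs_counterGain_le (μ := μ) hu r (y (T + 0) ω))).1
    simp only [Nat.cast_zero, mul_zero, add_zero] at h2 ⊢
    nlinarith
  | succ k ih =>
    have hAm := hc.measurableSet_staySet hV ε hB k
    have hstep := hc.setLIntegral_step (T + k) (f := fun z w =>
      ENNReal.ofReal (Real.exp (-(l * (max (z.2.2 + u (-(inner ℝ (φ z.1 + w) z.2.1))) 0
        + counterGain μ u r (φ z.1 + w)))))) (by unfold Function.uncurry; fun_prop) hAm
    simp only [← hc.y_succ, ← hc.s_succ] at hstep
    calc _ ≤ ∫⁻ ω in staySet V x ε T B k, ENNReal.ofReal (Real.exp (-(l * (s (T + k + 1) ω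
          + counterGain μ u r (y (T + k + 1) ω))))) ∂P :=
          lintegral_mono_set (antitone_staySet V x ε T B (Nat.le_succ k))
      _ ≤ ∫⁻ ω in staySet V x ε T B k, ENNReal.ofReal (Real.exp (-(l * (κ / 2)))) *
          ENNReal.ofReal (Real.exp (-(l * (s (T + k) ω
            + counterGain μ u r (y (T + k) ω))))) ∂P := by
          rw [hstep]
          exact setLIntegral_mono' (F.le _ _ hAm) fun ω hω =>
            hdrift _ (hε _ (potential_le_of_mem_staySet hBV hω)) _ _
      _ ≤ ENNReal.ofReal (Real.exp (-(l * (κ / 2)))) *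
          (ENNReal.ofReal (Real.exp (-(l * (κ / 2) * k) - l * (S₁ - b))) * P B) := by
          rw [lintegral_const_mul' _ _ ENNReal.ofReal_ne_top]
          gcongr
      _ = _ := by
          rw [← mul_assoc, ← ENNReal.ofReal_mul (Real.exp_pos _).le, ← Real.exp_add]
          congr 3
          push_cast
          ring

/-- A state near the stationary point with a large counter is followed by square summable steps
with probability at least one half. -/
lemma exists_half_le_measure_summable (hc : KestenChain P F μ φ γ u ξ x y s)
    (hγ : IsStepFunction γ) (hμ : IsNoiseLaw μ) (hu : IsSigmoid u b)
    (h : LyapunovAssumptions φ xs (γ 0) (covMatrix μ id) V M) {r₁ κ : ℝ} (hr₁ : 0 < r₁)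
    (hκ0 : 0 < κ)
    (hκ : ∀ p : Vec n, ‖p‖ ≤ r₁ → κ ≤ ∫ w, counterGain μ u r₁ (p + w) ∂μ) :
    ∃ r S₁ : ℝ, 0 < r ∧ ∀ t B, MeasurableSet[F t] B →
      B ⊆ {ω | ‖x t ω - xs‖ ≤ r ∧ S₁ ≤ s t ω} →
      ENNReal.ofReal (1 / 2) * P B ≤ P (B ∩ {ω | Summable fun t => γ (s t ω) ^ 2}) := by
  have hV := h.continuous_V
  have htr := trace_covMatrix_mul_nonneg hμ.memLp_two hμ.mean_zero h.posDef
  obtain ⟨l, hl, hdrift⟩ := exists_exp_drift hu hκ0 hκ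
  obtain ⟨C, hC, hpot⟩ := hc.exists_setLIntegral_potential_succ_le hγ hμ h
  obtain ⟨ε, hε0, hε⟩ : ∃ ε : ℝ, 0 < ε ∧ ∀ z, V z ≤ ε → ‖φ z‖ ≤ r₁ := by
    obtain ⟨r, hr, hball⟩ := Metric.continuousAt_iff.1 h.continuous_field.continuousAt r₁ hr₁
    obtain ⟨ε, hε, hsub⟩ := h.exists_sublevel_subset_ball (hγ.pos 0) htr hr
    refine ⟨ε, hε, fun z hz => ?_⟩
    have := hball (x := z) (by simpa [dist_eq_norm] using hsub z hz)
    rw [h.stationary, dist_zero_right] at this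
    exact this.le
  obtain ⟨r, hr, hrV⟩ : ∃ r : ℝ, 0 < r ∧ ∀ z, ‖z - xs‖ ≤ r → V z ≤ ε / 4 := by
    have hev : ∀ᶠ z in 𝓝 xs, V z < ε / 4 :=
      hV.continuousAt.eventually (gt_mem_nhds (by rw [h.zero]; positivity))
    obtain ⟨r, hr, hball⟩ := Metric.nhds_basis_closedBall.eventually_iff.1 hev
    exact ⟨r, hr, fun z hz => (hball (by simpa [dist_eq_norm] using hz)).le⟩
  -- Half of the rate `κ / 2` in the exponential bound: a counter below `θ * (k + N)` at time `T +
  -- k` is exponentially unlikely.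
  set θ := κ / 4 with hθ
  have hθ0 : 0 < θ := by positivity
  set C' := γ 0 ^ 2 * Real.exp (2 * l * b) with hC'
  have hC'0 : 0 ≤ C' := by positivity
  -- A bound for the mean squared step: the first term is for a counter of at least `θ * j`, the
  -- second is the Chernoff bound for the complementary case.
  set a : ℕ → ℝ := fun j => γ (θ * j) ^ 2 + C' * Real.exp (-(l * θ)) ^ j with ha
  have ha0 : ∀ j, 0 ≤ a j := fun j => by positivity
  have hasum : Summable a := (hγ.summable_sq θ hθ0).add
    ((summable_geometric_of_lt_one (Real.exp_pos _).le
      (Real.exp_lt_one_iff.2 (by nlinarith))).mul_left C')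
  obtain ⟨N, hN⟩ : ∃ N : ℕ, C * ∑' k, a (k + N) ≤ ε / 4 := by
    have := (tendsto_sum_nat_add a).const_mul C
    rw [mul_zero] at this
    obtain ⟨N, hN⟩ := (this.eventually (gt_mem_nhds (by positivity : 0 < ε / 4))).exists
    exact ⟨N, hN.le⟩
  have hasumN : Summable fun k => a (k + N) := (summable_nat_add_iff N).2 hasum
  -- Starting the counter at `2 * θ * N` acts like a head start of `N` steps, so only the tail of
  -- `a` from `N` on enters.
  refine ⟨r, 2 * θ * N, hr, fun T B hB hBsub => ?_⟩
  have hBV' : ∀ ω ∈ B, V (x T ω) ≤ ε / 4 := fun ω hω => hrV _ (hBsub hω).1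
  have hBV : ∀ ω ∈ B, V (x T ω) ≤ ε := fun ω hω => (hBV' ω hω).trans (by linarith)
  set A := staySet V x ε T B with hA
  have hAm : ∀ k, MeasurableSet[F (T + k)] (A k) := hc.measurableSet_staySet hV ε hB
  have hAB : ∀ k, A k ⊆ B := fun k => inter_subset_left
  have hsq : ∀ k : ℕ, ∫⁻ ω in A k, ENNReal.ofReal (γ (s (T + k) ω) ^ 2) ∂P
      ≤ ENNReal.ofReal (a (k + N)) * P B := by
    intro k
    have hexp := hc.setLIntegral_exp_staySet_le hu h.continuous_field hV hdrift hl hε hB hBV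
      (fun ω hω => (hBsub hω).2) k
    set c := γ 0 ^ 2 * Real.exp (l * (θ * (k + N) + b)) with hc_def
    have hc0 : 0 ≤ c := by positivity
    have hpt : ∀ ω, γ (s (T + k) ω) ^ 2 ≤ γ (θ * (k + N)) ^ 2 + c * Real.exp (-(l *
        (s (T + k) ω + counterGain μ u r₁ (y (T + k) ω)))) := fun ω => by
      rcases le_total (θ * (k + N)) (s (T + k) ω) with hs | hs
      · have h1 := pow_le_pow_left₀ (hγ.pos _).le (hγ.antitone hs) 2
        have h2 : 0 ≤ c * Real.exp (-(l *
          (s (T + k) ω + counterGain μ u r₁ (y (T + k) ω)))) := by positivity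
        linarith
      · have h1 := pow_le_pow_left₀ (hγ.pos _).le (hγ.antitone (hc.s_nonneg (T + k) ω)) 2
        have h2 : 1 ≤ Real.exp (l * (θ * (k + N) + b)) * Real.exp (-(l *
            (s (T + k) ω + counterGain μ u r₁ (y (T + k) ω)))) := by
          rw [← Real.exp_add, Real.one_le_exp_iff]
          have h3 := (abs_le.1 (abs_counterGain_le (μ := μ) hu r₁ (y (T + k) ω))).2
          nlinarith
        have h3 : 0 ≤ γ (θ * (k + N)) ^ 2 := sq_nonneg _
        rw [hc_def, mul_assoc]
        nlinarith [sq_nonneg (γ 0)]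
    calc _ ≤ ∫⁻ ω in A k, (ENNReal.ofReal (γ (θ * (k + N)) ^ 2) + ENNReal.ofReal c *
          ENNReal.ofReal (Real.exp (-(l *
            (s (T + k) ω + counterGain μ u r₁ (y (T + k) ω)))))) ∂P := by
          refine lintegral_mono fun ω => ?_
          rw [← ENNReal.ofReal_mul hc0, ← ENNReal.ofReal_add (sq_nonneg _) (by positivity)]
          exact ENNReal.ofReal_le_ofReal (hpt ω)
      _ ≤ ENNReal.ofReal (γ (θ * (k + N)) ^ 2) * P B + ENNReal.ofReal c *
          (ENNReal.ofReal (Real.exp (-(l * (κ / 2) * k) - l * (2 * θ * N - b))) * P B) := by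
          rw [lintegral_add_left measurable_const, setLIntegral_const,
            lintegral_const_mul' _ _ ENNReal.ofReal_ne_top]
          gcongr
          exact hAB k
      _ = _ := by
          rw [← mul_assoc, ← add_mul, ← ENNReal.ofReal_mul hc0,
            ← ENNReal.ofReal_add (sq_nonneg _) (by positivity)]
          congr 2
          simp only [ha, hc_def, hC']
          push_cast
          have he : l * (θ * (k + N) + b) + (-(l * (κ / 2) * k) - l * (2 * θ * N - b))
              = 2 * l * b + ((k + N : ℕ) : ℝ) * -(l * θ) := by
            push_cast
            rw [hθ]
            ring
          have he' : Real.exp (l * (θ * (k + N) + b))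
              * Real.exp (-(l * (κ / 2) * k) - l * (2 * θ * N - b))
              = Real.exp (2 * l * b) * Real.exp (-(l * θ)) ^ (k + N) := by
            rw [← Real.exp_nat_mul, ← Real.exp_add, ← Real.exp_add, he]
          linear_combination γ 0 ^ 2 * he'
  have hsqsum : ∀ K : ℕ, ∑ k ∈ Finset.range K,
      ∫⁻ ω in A k, ENNReal.ofReal (γ (s (T + k) ω) ^ 2) ∂P
        ≤ ENNReal.ofReal (∑' k, a (k + N)) * P B := fun K => by
    refine (Finset.sum_le_sum fun k _ => hsq k).trans ?_
    rw [← Finset.sum_mul, ← ENNReal.ofReal_sum_of_nonneg fun k _ => ha0 _]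
    gcongr
    exact hasumN.sum_le_tsum _ fun k _ => ha0 _
  have hpotA : ∀ k : ℕ, (∫⁻ ω in A (k + 1), ENNReal.ofReal (V (x (T + (k + 1)) ω)) ∂P)
      + ENNReal.ofReal ε * P (A k \ A (k + 1))
      ≤ (∫⁻ ω in A k, ENNReal.ofReal (V (x (T + k) ω)) ∂P)
        + ENNReal.ofReal C * ∫⁻ ω in A k, ENNReal.ofReal (γ (s (T + k) ω) ^ 2) ∂P := by
    intro k
    refine le_trans ?_ (hpot (T + k) (A k) (hAm k))
    have hm1 : MeasurableSet (A (k + 1)) := F.le _ _ (hAm (k + 1))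
    have hm0 : MeasurableSet (A k) := F.le _ _ (hAm k)
    rw [← lintegral_inter_add_sdiff _ (A k) hm1, inter_eq_right.2
      (antitone_staySet V x ε T B (Nat.le_succ k)), ← setLIntegral_const]
    refine add_le_add le_rfl (setLIntegral_mono' (hm0.diff hm1) fun ω hω =>
      ENNReal.ofReal_le_ofReal ?_)
    by_contra! hlt
    refine hω.2 ?_
    rw [hA, staySet_succ]
    exact ⟨hω.1, hlt.le⟩
  -- A maximal inequality, in additive form to avoid subtraction: paths that leave carry potential
  -- at least `ε`, while the initial potential and its total growth contribute at most `ε / 4` each.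
  -- Hence at most half of `B` is lost.
  have hexit : ∀ K : ℕ, (∫⁻ ω in A K, ENNReal.ofReal (V (x (T + K) ω)) ∂P)
      + ENNReal.ofReal ε * P B
      ≤ (∫⁻ ω in B, ENNReal.ofReal (V (x T ω)) ∂P) + (ENNReal.ofReal C * ∑ k ∈ Finset.range K,
        ∫⁻ ω in A k, ENNReal.ofReal (γ (s (T + k) ω) ^ 2) ∂P) + ENNReal.ofReal ε * P (A K) := by
    intro K
    induction K with
    | zero => simp [hA, staySet_zero]
    | succ K ih =>
      have hm1 : MeasurableSet (A (K + 1)) := F.le _ _ (hAm (K + 1))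
      have hsplit : P (A K) = P (A (K + 1)) + P (A K \ A (K + 1)) := by
        rw [← measure_inter_add_sdiff (A K) hm1, inter_eq_right.2
          (antitone_staySet V x ε T B (Nat.le_succ K))]
      have hfin : ENNReal.ofReal ε * P (A K \ A (K + 1)) ≠ ⊤ :=
        ENNReal.mul_ne_top ENNReal.ofReal_ne_top (measure_ne_top _ _)
      rw [← ENNReal.add_le_add_iff_right hfin, Finset.sum_range_succ, mul_add]
      calc _ = ((∫⁻ ω in A (K + 1), ENNReal.ofReal (V (x (T + (K + 1)) ω)) ∂P)
            + ENNReal.ofReal ε * P (A K \ A (K + 1))) + ENNReal.ofReal ε * P B := by ring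
        _ ≤ ((∫⁻ ω in A K, ENNReal.ofReal (V (x (T + K) ω)) ∂P)
            + ENNReal.ofReal C * ∫⁻ ω in A K, ENNReal.ofReal (γ (s (T + K) ω) ^ 2) ∂P)
            + ENNReal.ofReal ε * P B :=
            add_le_add (hpotA K) le_rfl
        _ = ((∫⁻ ω in A K, ENNReal.ofReal (V (x (T + K) ω)) ∂P) + ENNReal.ofReal ε * P B)
            + ENNReal.ofReal C * ∫⁻ ω in A K, ENNReal.ofReal (γ (s (T + K) ω) ^ 2) ∂P := by ring
        _ ≤ _ := add_le_add ih le_rfl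
        _ = _ := by rw [hsplit]; ring
  have hstay : ∀ K, ENNReal.ofReal (1 / 2) * P B ≤ P (A K) := by
    intro K
    have h1 : ENNReal.ofReal ε * P B ≤ ENNReal.ofReal (ε / 4) * P B
        + ENNReal.ofReal (ε / 4) * P B + ENNReal.ofReal ε * P (A K) := by
      refine (le_add_self.trans (hexit K)).trans (add_le_add (add_le_add ?_ ?_) le_rfl)
      · rw [← setLIntegral_const]
        exact setLIntegral_mono' (F.le T _ hB) fun ω hω => ENNReal.ofReal_le_ofReal (hBV' ω hω)
      · refine (mul_le_mul_right (hsqsum K) _).trans ?_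
        rw [← mul_assoc, ← ENNReal.ofReal_mul hC]
        gcongr
    have h2 := ENNReal.toReal_mono (by finiteness) h1
    rw [ENNReal.toReal_add (by finiteness) (by finiteness), ENNReal.toReal_add (by finiteness)
      (by finiteness)] at h2
    simp only [ENNReal.toReal_mul, ENNReal.toReal_ofReal hε0.le,
      ENNReal.toReal_ofReal (by positivity : 0 ≤ ε / 4)] at h2
    rw [← ENNReal.toReal_le_toReal (by finiteness) (by finiteness), ENNReal.toReal_mul,
      ENNReal.toReal_ofReal (by norm_num)]
    nlinarith
  set A' := ⋂ k, A k with hA'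
  have hA'm : MeasurableSet A' := MeasurableSet.iInter fun k => F.le _ _ (hAm k)
  have hhalf : ENNReal.ofReal (1 / 2) * P B ≤ P A' := by
    have := tendsto_measure_iInter_atTop (μ := P) (s := A)
      (fun k => (F.le _ _ (hAm k)).nullMeasurableSet) (antitone_staySet V x ε T B)
      ⟨0, measure_ne_top _ _⟩
    exact ge_of_tendsto' this hstay
  have hsm : ∀ k, Measurable fun ω => ENNReal.ofReal (γ (s (T + k) ω) ^ 2) := fun k =>
    ((hγ.measurable.comp ((hc.measurable_s (T + k)).mono (F.le _) le_rfl)).pow_const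
      2).ennreal_ofReal
  -- Among the paths that never leave, the sum of squared steps has finite integral, hence is finite
  -- almost everywhere.
  have hfin : ∫⁻ ω in A', ∑' k, ENNReal.ofReal (γ (s (T + k) ω) ^ 2) ∂P ≠ ⊤ := by
    rw [lintegral_tsum fun k => (hsm k).aemeasurable]
    refine ne_top_of_le_ne_top (b := ENNReal.ofReal (∑' k, a (k + N)) * P B) (by finiteness) ?_
    refine ENNReal.tsum_le_of_sum_range_le fun K => ?_
    refine (Finset.sum_le_sum fun k _ => ?_).trans (hsqsum K)
    exact lintegral_mono_set (iInter_subset _ k)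
  have hae := ae_lt_top (Measurable.tsum hsm) hfin
  rw [ae_restrict_iff' hA'm] at hae
  refine hhalf.trans (measure_mono_ae ?_)
  filter_upwards [hae] with ω hω hωA
  refine ⟨hAB 0 (mem_iInter.1 hωA 0), ?_⟩
  have := (summable_iff_tsum_ofReal_ne_top fun _ => sq_nonneg _).2 (hω hωA).ne
  rw [mem_ofPred_eq, ← summable_nat_add_iff T]
  simpa only [add_comm] using this

end KestenChain

/-- A nonnegative process with decreasing integrals over the events of the past converges. -/
lemma ae_exists_tendsto_of_setLIntegral_le {Ω : Type*} {m : MeasurableSpace Ω} {P : Measure Ω}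
    [IsFiniteMeasure P] {F : Filtration ℕ m} {W : ℕ → Ω → ℝ} (hW : ∀ t, Measurable[F t] (W t))
    (hW0 : ∀ t ω, 0 ≤ W t ω) {K : ℝ} (hK : ∀ ω, W 0 ω ≤ K)
    (hle : ∀ t B, MeasurableSet[F t] B →
      ∫⁻ ω in B, ENNReal.ofReal (W (t + 1) ω) ∂P ≤ ∫⁻ ω in B, ENNReal.ofReal (W t ω) ∂P) :
    ∀ᵐ ω ∂P, ∃ c, Tendsto (fun t => W t ω) atTop (𝓝 c) := by
  have hm : ∀ t, Measurable (W t) := fun t => (hW t).mono (F.le t) le_rfl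
  have hbound : ∀ t, ∫⁻ ω, ENNReal.ofReal (W t ω) ∂P ≤ ENNReal.ofReal K * P univ := by
    intro t
    induction t with
    | zero =>
      rw [← lintegral_const]
      exact lintegral_mono fun ω => ENNReal.ofReal_le_ofReal (hK ω)
    | succ t ih =>
      refine le_trans ?_ ih
      simpa using hle t univ MeasurableSet.univ
  have hfin : ENNReal.ofReal K * P univ ≠ ⊤ := by finiteness
  have hint : ∀ t, Integrable (W t) P := fun t => by
    refine ⟨(hm t).aestronglyMeasurable, ?_⟩
    rw [hasFiniteIntegral_iff_ofReal (ae_of_all _ (hW0 t))]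
    exact (hbound t).trans_lt hfin.lt_top
  have hsuper : Supermartingale W F P := by
    refine supermartingale_of_setIntegral_succ_le (fun t => (hW t).stronglyMeasurable) hint
      fun t B hB => ?_
    rw [integral_eq_lintegral_of_nonneg_ae (ae_of_all _ (hW0 _)) (hm _).aestronglyMeasurable,
      integral_eq_lintegral_of_nonneg_ae (ae_of_all _ (hW0 _)) (hm _).aestronglyMeasurable]
    refine ENNReal.toReal_mono ?_ (hle t B hB)
    exact ne_top_of_le_ne_top hfin ((setLIntegral_le_lintegral _ _).trans (hbound t))
  have hconv := hsuper.neg.ae_tendsto_limitProcess (R := (ENNReal.ofReal K * P univ).toNNReal)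
    (fun t => by
      rw [ENNReal.coe_toNNReal hfin, eLpNorm_one_eq_lintegral_enorm]
      refine le_trans (le_of_eq (lintegral_congr fun ω => ?_)) (hbound t)
      rw [Pi.neg_apply, Pi.neg_apply, enorm_neg, Real.enorm_of_nonneg (hW0 t ω)])
  filter_upwards [hconv] with ω hω
  exact ⟨_, by simpa using hω.neg⟩

/-! ### Convergence of the potential and of the estimates. -/

namespace KestenChain

variable {n : ℕ} {Ω : Type*} {m : MeasurableSpace Ω} {P : Measure Ω}
  {F : Filtration ℕ m} {μ : Measure (Vec n)} {φ : Vec n → Vec n}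
  {γ u : ℝ → ℝ} {b : ℝ} {ξ x y : ℕ → Ω → Vec n} {s : ℕ → Ω → ℝ}
  {xs : Vec n} {V : Vec n → ℝ} {M : Matrix (Fin n) (Fin n) ℝ}
  [IsProbabilityMeasure P] [IsProbabilityMeasure μ]

/-- The potential converges where the steps are square summable. -/
lemma ae_exists_tendsto_potential (hc : KestenChain P F μ φ γ u ξ x y s)
    (hγ : IsStepFunction γ) (hμ : IsNoiseLaw μ)
    (h : LyapunovAssumptions φ xs (γ 0) (covMatrix μ id) V M) :
    ∀ᵐ ω ∂P, (Summable fun t => γ (s t ω) ^ 2) →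
      ∃ c, Tendsto (fun t => V (x t ω)) atTop (𝓝 c) := by
  obtain ⟨C, hC, hpot⟩ := hc.exists_setLIntegral_potential_succ_le hγ hμ h
  have hV := h.continuous_V
  set Q : ℕ → Ω → ℝ := fun t ω => ∑ i ∈ Finset.range t, γ (s i ω) ^ 2 with hQ
  have hγs : ∀ t, Measurable[F t] fun ω => γ (s t ω) ^ 2 := fun t =>
    (hγ.measurable.pow_const 2).comp (hc.measurable_s t)
  have hQm : ∀ t, Measurable[F t] (Q (t + 1)) := fun t =>
    Finset.measurable_fun_sum _ fun i hi =>
      (hγs i).mono (F.mono (by simp at hi; omega)) le_rfl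
  have hQm' : ∀ t, Measurable[F t] (Q t) := fun t =>
    Finset.measurable_fun_sum _ fun i hi =>
      (hγs i).mono (F.mono (by simp at hi; omega)) le_rfl
  have hVm : ∀ t, Measurable[F t] fun ω => V (x t ω) := fun t =>
    hV.measurable.comp (hc.measurable_x t)
  -- Adding `C * (K - Q t)` compensates the growth of `V` and gives a supermartingale. The indicator
  -- keeps it nonnegative by killing the path once `Q` exceeds `K`, and bounds it at time zero.
  have hconv : ∀ K : ℕ, ∀ᵐ ω ∂P, ∃ c, Tendsto
      (fun t => ({ω | V (x 0 ω) ≤ K} ∩ {ω | Q t ω ≤ K}).indicator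
        (fun ω => V (x t ω) + C * (K - Q t ω)) ω) atTop (𝓝 c) := by
    intro K
    set I : ℕ → Set Ω := fun t => {ω | V (x 0 ω) ≤ K} ∩ {ω | Q t ω ≤ K} with hI
    have hV0 : ∀ t, MeasurableSet[F t] {ω | V (x 0 ω) ≤ K} := fun t =>
      F.mono (Nat.zero_le t) _ (hc.measurableSet_potential_le hV 0 K)
    -- The step from `t` is already determined at time `t`, so the killing is predictable.
    have hIm : ∀ t, MeasurableSet[F t] (I (t + 1)) := fun t =>
      (hV0 t).inter ((hQm t) measurableSet_Iic)
    have hIm' : ∀ t, MeasurableSet[F t] (I t) := fun t =>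
      (hV0 t).inter ((hQm' t) measurableSet_Iic)
    have hIsub : ∀ t, I (t + 1) ⊆ I t := fun t ω hω => by
      have h2 : Q (t + 1) ω ≤ K := hω.2
      refine ⟨hω.1, ?_⟩
      simp only [hQ, Finset.sum_range_succ, mem_ofPred_eq] at h2 ⊢
      linarith [sq_nonneg (γ (s t ω))]
    have hnn : ∀ t, ∀ ω ∈ I t, 0 ≤ C * (K - Q t ω) := fun t ω hω =>
      mul_nonneg hC (sub_nonneg.2 hω.2)
    have hint : ∀ t B, MeasurableSet B → ∫⁻ ω in B, ENNReal.ofReal ((I t).indicator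
        (fun ω => V (x t ω) + C * (K - Q t ω)) ω) ∂P
        = (∫⁻ ω in B ∩ I t, ENNReal.ofReal (V (x t ω)) ∂P)
          + ∫⁻ ω in B ∩ I t, ENNReal.ofReal (C * (K - Q t ω)) ∂P := fun t B hB => by
      rw [← lintegral_add_left (((hVm t).mono (F.le t) le_rfl).ennreal_ofReal),
        inter_comm, ← setLIntegral_indicator (F.le t _ (hIm' t))]
      refine lintegral_congr fun ω => ?_
      by_cases hω : ω ∈ I t
      · simp only [indicator_of_mem hω]
        rw [ENNReal.ofReal_add (h.nonneg _) (hnn t ω hω)]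
      · simp only [indicator_of_notMem hω, ENNReal.ofReal_zero]
    refine ae_exists_tendsto_of_setLIntegral_le (F := F) (K := K + C * K)
      (fun t => Measurable.indicator ((hVm t).add ((measurable_const.sub (hQm' t)).const_mul C))
        (hIm' t))
      (fun t => indicator_nonneg fun ω hω => add_nonneg (h.nonneg _) (hnn t ω hω))
      (fun ω => ?_) (fun t B hB => ?_)
    · have hK : (0 : ℝ) ≤ K + C * K := by positivity
      refine indicator_apply_le' (fun hω => ?_) fun _ => hK
      have : V (x 0 ω) ≤ K := hω.1
      simp only [hQ, Finset.range_zero, Finset.sum_empty, sub_zero]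
      linarith
    · rw [hint _ _ (F.le t _ hB), hint _ _ (F.le t _ hB)]
      have hD := hB.inter (hIm t)
      have hDm := F.le t _ hD
      have hsub : B ∩ I (t + 1) ⊆ B ∩ I t := inter_subset_inter_right _ (hIsub t)
      calc _ ≤ ((∫⁻ ω in B ∩ I (t + 1), ENNReal.ofReal (V (x t ω)) ∂P)
            + ENNReal.ofReal C * ∫⁻ ω in B ∩ I (t + 1), ENNReal.ofReal (γ (s t ω) ^ 2) ∂P)
            + ∫⁻ ω in B ∩ I (t + 1), ENNReal.ofReal (C * (K - Q (t + 1) ω)) ∂P :=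
            add_le_add (hpot t _ hD) le_rfl
        _ = (∫⁻ ω in B ∩ I (t + 1), ENNReal.ofReal (V (x t ω)) ∂P)
            + ∫⁻ ω in B ∩ I (t + 1), ENNReal.ofReal (C * (K - Q t ω)) ∂P := by
            rw [add_assoc, ← lintegral_const_mul' _ _ ENNReal.ofReal_ne_top,
              ← lintegral_add_left (((hγs t).mono (F.le t) le_rfl).ennreal_ofReal.const_mul _)]
            congr 1
            refine setLIntegral_congr_fun hDm fun ω hω => ?_
            rw [← ENNReal.ofReal_mul hC, ← ENNReal.ofReal_add (by positivity) (hnn _ ω hω.2)]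
            congr 1
            simp only [hQ, Finset.sum_range_succ]
            ring
        _ ≤ _ := add_le_add (lintegral_mono_set hsub) (lintegral_mono_set hsub)
  filter_upwards [ae_all_iff.2 hconv] with ω hω hs
  -- For such `K` this path is never killed, and the compensator converges by itself.
  obtain ⟨K, hK⟩ := exists_nat_ge (max (V (x 0 ω)) (∑' t, γ (s t ω) ^ 2))
  obtain ⟨c, hcv⟩ := hω K
  have hmem : ∀ t, ω ∈ {ω | V (x 0 ω) ≤ K} ∩ {ω | Q t ω ≤ K} := fun t =>
    ⟨(le_max_left _ _).trans hK,
      (hs.sum_le_tsum _ fun i _ => sq_nonneg _).trans ((le_max_right _ _).trans hK)⟩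
  simp only [indicator_of_mem (hmem _)] at hcv
  have hQlim : Tendsto (fun t => Q t ω) atTop (𝓝 (∑' t, γ (s t ω) ^ 2)) :=
    hs.hasSum.tendsto_sum_nat
  refine ⟨c - C * (K - ∑' t, γ (s t ω) ^ 2), ?_⟩
  have := hcv.sub ((hQlim.const_sub (K : ℝ)).const_mul C)
  simpa using this

/-- The estimates converge to the stationary point. -/
theorem ae_tendsto [Nontrivial (Vec n)] (hc : KestenChain P F μ φ γ u ξ x y s)
    (hγ : IsStepFunction γ) (hμ : IsNoiseLaw μ) (hu : IsSigmoid u b)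
    (h : LyapunovAssumptions φ xs (γ 0) (covMatrix μ id) V M) {r κ : ℝ} (hr : 0 < r)
    (hκ0 : 0 < κ)
    (hκ : ∀ p : Vec n, ‖p‖ ≤ r → κ ≤ ∫ w, counterGain μ u r (p + w) ∂μ) :
    ∀ᵐ ω ∂P, Tendsto (fun t => x t ω) atTop (𝓝 xs) := by
  have htr := trace_covMatrix_mul_nonneg hμ.memLp_two hμ.mean_zero h.posDef
  obtain ⟨r', S₁, hr', hhalf⟩ := hc.exists_half_le_measure_summable hγ hμ hu h hr hκ0 hκ
  have hGm : ∀ t, MeasurableSet[F t] {ω | ‖x t ω - xs‖ ≤ r' ∧ S₁ ≤ s t ω} := fun t => by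
    have h1 : Measurable[F t] fun ω => ‖x t ω - xs‖ :=
      (by fun_prop : Measurable fun z : Vec n => ‖z - xs‖).comp (hc.measurable_x t)
    exact (h1 measurableSet_Iic).inter ((hc.measurable_s t) measurableSet_Ici)
  have hsum := ae_mem_of_frequently hGm (hc.measurableSet_summable_sq hγ)
    (by norm_num : (0 : ℝ) < 1 / 2) hhalf
  have hsmall : ∀ᵐ ω ∂P, ∀ k : ℕ, ∃ᶠ t in atTop, V (x t ω) ≤ 1 / ((k : ℝ) + 1) :=
    ae_all_iff.2 fun k => hc.ae_frequently_potential_le hγ hμ hu h (by positivity)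
  filter_upwards [hc.ae_frequently_near_and_counter_ge hγ hμ hu h hr' S₁, hsum,
    hc.ae_exists_tendsto_potential hγ hμ h, hsmall] with ω h1 h2 h3 h4
  obtain ⟨c, hcv⟩ := h3 (h2 h1)
  have hc0 : 0 ≤ c := ge_of_tendsto' hcv fun t => h.nonneg _
  have hc1 : c = 0 := by
    by_contra hne
    have hpos : 0 < c := lt_of_le_of_ne hc0 (Ne.symm hne)
    obtain ⟨k, hk⟩ := exists_nat_one_div_lt hpos
    obtain ⟨t, ht, ht'⟩ := ((h4 k).and_eventually (hcv.eventually (lt_mem_nhds hk))).exists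
    linarith
  exact h.tendsto_of_tendsto_zero (hγ.pos 0) htr (hc1 ▸ hcv)

end KestenChain

/-! ### Independence of a pair from a third variable. -/

section Independence

variable {Ω α β δ : Type*} {m : MeasurableSpace Ω} {P : Measure Ω} [IsProbabilityMeasure P]
  [MeasurableSpace α] [MeasurableSpace β] [MeasurableSpace δ]

/-- The joint law factors into three, and the product measure is reassociated. This joins the
initial counters, independent of the whole source family, to the past of that family. -/
lemma indepFun_prodMk_left {X : Ω → α} {Y : Ω → β} {Z : Ω → δ} (hX : Measurable X)
    (hY : Measurable Y) (hZ : Measurable Z) (h : IndepFun X (fun ω => (Y ω, Z ω)) P)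
    (h' : IndepFun Y Z P) : IndepFun (fun ω => (X ω, Y ω)) Z P := by
  have hXY : IndepFun X Y P := h.comp measurable_id measurable_fst
  have : IsProbabilityMeasure (P.map X) := Measure.isProbabilityMeasure_map hX.aemeasurable
  have : IsProbabilityMeasure (P.map Y) := Measure.isProbabilityMeasure_map hY.aemeasurable
  have : IsProbabilityMeasure (P.map Z) := Measure.isProbabilityMeasure_map hZ.aemeasurable
  have h1 := (indepFun_iff_map_prod_eq_prod_map_map hX.aemeasurable
    (hY.prodMk hZ).aemeasurable).1 h
  have h2 := (indepFun_iff_map_prod_eq_prod_map_map hY.aemeasurable hZ.aemeasurable).1 h'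
  have h3 := (indepFun_iff_map_prod_eq_prod_map_map hX.aemeasurable hY.aemeasurable).1 hXY
  rw [indepFun_iff_map_prod_eq_prod_map_map (hX.prodMk hY).aemeasurable hZ.aemeasurable, h3]
  refine MeasurableEquiv.prodAssoc.map_measurableEquiv_injective ?_
  rw [Measure.prodAssoc_prod, ← h2, ← h1,
    Measure.map_map MeasurableEquiv.prodAssoc.measurable ((hX.prodMk hY).prodMk hZ)]
  rfl

end Independence

/-! ### The worst scalar product and the counter gain. -/

section WorstProduct

variable {n : ℕ}

lemma worstProduct_le {r : ℝ} (hr : 0 ≤ r) (a c : Vec n) {p : Vec n} (hp : ‖p‖ ≤ r) :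
    worstProduct r a c ≤ -(inner ℝ c (p + a)) - r * ‖p + a‖ := by
  have hbdd : BddBelow (range fun pq : Metric.closedBall (0 : Vec n) r ×
      Metric.closedBall (0 : Vec n) r => -(inner ℝ (a + (pq.1 : Vec n)) (c + (pq.2 : Vec n)))) := by
    refine ⟨-((‖a‖ + r) * (‖c‖ + r)), ?_⟩
    rintro _ ⟨⟨⟨p, hp⟩, ⟨q, hq⟩⟩, rfl⟩
    rw [mem_closedBall_zero_iff] at hp hq
    have h1 : ‖a + p‖ ≤ ‖a‖ + r := (norm_add_le _ _).trans (by linarith)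
    have h2 : ‖c + q‖ ≤ ‖c‖ + r := (norm_add_le _ _).trans (by linarith)
    have h3 : ‖a + p‖ * ‖c + q‖ ≤ (‖a‖ + r) * (‖c‖ + r) := by gcongr
    have h4 := real_inner_le_norm (a + p) (c + q)
    simp only
    linarith
  -- The perturbation of `c` of length `r` along `p + a` is the worst one; for `p + a = 0` the
  -- convention `0⁻¹ = 0` makes it zero.
  have hq : ‖(r * ‖p + a‖⁻¹) • (p + a)‖ ≤ r := by
    rw [norm_smul, norm_mul, Real.norm_of_nonneg hr, norm_inv, norm_norm, mul_assoc]
    exact mul_le_of_le_one_right hr inv_mul_le_one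
  refine (ciInf_le hbdd ⟨⟨p, by simpa using hp⟩,
    ⟨(r * ‖p + a‖⁻¹) • (p + a), by simpa using hq⟩⟩).trans (le_of_eq ?_)
  simp only
  rw [add_comm a p, inner_add_right, real_inner_smul_right, real_inner_self_eq_norm_sq,
    real_inner_comm]
  by_cases h0 : ‖p + a‖ = 0
  · simp [h0]
  · field_simp
    ring

end WorstProduct

namespace SigmoidAssumptions

variable {n : ℕ} {Ω : Type*} [MeasurableSpace Ω] {P : Measure Ω}
  {ζ₁ ζ₂ : Ω → Vec n} {u : ℝ → ℝ}

lemma exists_isSigmoid (h : SigmoidAssumptions P ζ₁ ζ₂ u) : ∃ b, IsSigmoid u b := by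
  obtain ⟨c, hc, htop⟩ := h.limit_top
  obtain ⟨d, hbot⟩ := h.limit_bot
  refine ⟨|c| + |d|, h.monotone, h.pos_of_pos, by positivity, fun r => ?_⟩
  have h1 := h.monotone.ge_of_tendsto htop r
  have h2 := h.monotone.le_of_tendsto hbot r
  rw [abs_le]
  constructor <;> linarith [le_abs_self c, neg_abs_le d, abs_nonneg c, abs_nonneg d]

/-- Near the stationary point the counter has a positive expected gain. -/
lemma exists_le_integral_counterGain [IsProbabilityMeasure P]
    (h : SigmoidAssumptions P ζ₁ ζ₂ u) {μ : Measure (Vec n)} (h₁ : Measurable ζ₁)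
    (h₂ : Measurable ζ₂) (hμ₁ : P.map ζ₁ = μ) (hμ₂ : P.map ζ₂ = μ) (hind : IndepFun ζ₁ ζ₂ P) :
    ∃ r κ : ℝ, 0 < r ∧ 0 < κ ∧
      ∀ p : Vec n, ‖p‖ ≤ r → κ ≤ ∫ w, counterGain μ u r (p + w) ∂μ := by
  obtain ⟨b, hu⟩ := h.exists_isSigmoid
  obtain ⟨E, hE, hlim⟩ := h.limit_expectation_pos
  obtain ⟨r, hr, hr0⟩ := ((hlim.eventually (lt_mem_nhds hE)).and self_mem_nhdsWithin).exists
  refine ⟨r, ∫ ω, u (worstProduct r (ζ₁ ω) (ζ₂ ω)) ∂P, hr0, hr, fun p hp => ?_⟩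
  have : IsProbabilityMeasure μ := hμ₁ ▸ Measure.isProbabilityMeasure_map h₁.aemeasurable
  -- An undefined integral equals zero, so positivity of the integral already yields integrability,
  -- and measurability of the infimum need not be proved.
  have hint : Integrable (fun ω => u (worstProduct r (ζ₁ ω) (ζ₂ ω))) P := by
    by_contra hcon
    rw [integral_undef hcon] at hr
    exact lt_irrefl _ hr
  have hum := hu.measurable
  set f : Vec n × Vec n → ℝ := fun q => u (-(inner ℝ q.2 (p + q.1)) - r * ‖p + q.1‖) with hf
  have hfm : Measurable f := by fun_prop
  have hmap := (indepFun_iff_map_prod_eq_prod_map_map h₁.aemeasurable h₂.aemeasurable).1 hind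
  rw [hμ₁, hμ₂] at hmap
  have hfi : Integrable f (μ.prod μ) :=
    Integrable.of_bound hfm.aestronglyMeasurable b (ae_of_all _ fun q => hu.abs_le _)
  have hcalc : ∫ w, counterGain μ u r (p + w) ∂μ = ∫ ω, f (ζ₁ ω, ζ₂ ω) ∂P := by
    rw [← integral_map (φ := fun ω => (ζ₁ ω, ζ₂ ω)) (h₁.prodMk h₂).aemeasurable
      hfm.aestronglyMeasurable, hmap, integral_prod _ hfi]
    rfl
  rw [hcalc]
  refine integral_mono hint ?_ fun ω => hu.monotone (worstProduct_le hr0.le _ _ hp)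
  exact Integrable.of_bound (hfm.comp (h₁.prodMk h₂)).aestronglyMeasurable b
    (ae_of_all _ fun q => hu.abs_le _)

end SigmoidAssumptions

/-! ### Law of the noise and filtration of the history. -/

namespace NoiseAssumptions

variable {n : ℕ} {Ω : Type*} [m : MeasurableSpace Ω] {P : Measure Ω}
  {ξ : ℕ → Ω → Vec n} {x₀ : Ω → Vec n} {s₀ s₁ : Ω → ℝ}

lemma measurable_sourceFamily (h : NoiseAssumptions P ξ x₀ s₀ s₁) (t : ℕ) :
    Measurable (sourceFamily x₀ ξ t) := by
  unfold sourceFamily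
  split_ifs with ht
  · exact h.measurable_x₀
  · exact h.measurable_noise t (Nat.one_le_iff_ne_zero.2 ht)

lemma isNoiseLaw (h : NoiseAssumptions P ξ x₀ s₀ s₁) : IsNoiseLaw (P.map (ξ 1)) where
  memLp_two := by
    rw [memLp_map_measure_iff aestronglyMeasurable_id (h.measurable_noise 1 le_rfl).aemeasurable]
    exact h.memLp_two 1 le_rfl
  mean_zero := by
    rw [integral_map (f := fun w : Vec n => w) (h.measurable_noise 1 le_rfl).aemeasurable
      measurable_id.aestronglyMeasurable]
    exact h.mean_zero 1 le_rfl
  charges_balls := by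
    obtain ⟨ρ, hρ, hball⟩ := h.charges_balls
    refine ⟨ρ, hρ, fun c r hr hsub => ?_⟩
    rw [Measure.map_apply (h.measurable_noise 1 le_rfl) measurableSet_ball]
    exact hball c r hr hsub 1 le_rfl

lemma covMatrix_map (h : NoiseAssumptions P ξ x₀ s₀ s₁) :
    covMatrix (P.map (ξ 1)) id = covMatrix P (ξ 1) := by
  ext i j
  simp only [covMatrix, Matrix.of_apply, id]
  rw [integral_map (h.measurable_noise 1 le_rfl).aemeasurable]
  exact Measurable.aestronglyMeasurable (by fun_prop)

/-- The initial data and the noise up to a time. -/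
def history (ξ : ℕ → Ω → Vec n) (x₀ : Ω → Vec n) (s₀ s₁ : Ω → ℝ) (t : ℕ) (ω : Ω) :
    (ℝ × ℝ) × (Finset.range (t + 1) → Vec n) :=
  ((s₀ ω, s₁ ω), fun i => sourceFamily x₀ ξ i ω)

lemma measurable_history (h : NoiseAssumptions P ξ x₀ s₀ s₁) (t : ℕ) :
    Measurable (history ξ x₀ s₀ s₁ t) :=
  (h.measurable_s₀.prodMk h.measurable_s₁).prodMk
    (measurable_pi_lambda _ fun i => h.measurable_sourceFamily i)

/-- The filtration generated by the initial data and the noise, from time one on. -/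
def historyFiltration (h : NoiseAssumptions P ξ x₀ s₀ s₁) : Filtration ℕ m where
  seq t := MeasurableSpace.comap (history ξ x₀ s₀ s₁ (t + 1)) inferInstance
  mono' t t' htt' := by
    set g : (ℝ × ℝ) × (Finset.range (t' + 1 + 1) → Vec n) →
        (ℝ × ℝ) × (Finset.range (t + 1 + 1) → Vec n) := fun q =>
      (q.1, fun i => q.2 ⟨i, Finset.range_mono (by omega) i.2⟩) with hg
    have hgm : Measurable g := measurable_fst.prodMk
      (measurable_pi_lambda _ fun i => (measurable_pi_apply _).comp measurable_snd)
    have heq : history ξ x₀ s₀ s₁ (t + 1) = g ∘ history ξ x₀ s₀ s₁ (t' + 1) := rfl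
    simp only
    rw [heq]
    exact (hgm.comp (comap_measurable _)).comap_le
  le' t := (h.measurable_history (t + 1)).comap_le

/-- Index `t` of the filtration stands for time `t + 1`, so the next noise is `ξ (t + 2)`. -/
lemma indep_history [IsProbabilityMeasure P] (h : NoiseAssumptions P ξ x₀ s₀ s₁) (t : ℕ) :
    Indep (h.historyFiltration t) (MeasurableSpace.comap (ξ (t + 2)) inferInstance) P := by
  have hm := h.measurable_sourceFamily
  have h1 : IndepFun (fun ω (i : Finset.range (t + 1 + 1)) => sourceFamily x₀ ξ i ω)
      (sourceFamily x₀ ξ (t + 2)) P :=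
    (h.indep.indepFun_finset (Finset.range (t + 1 + 1)) {t + 2} (by simp) hm).comp
      (φ := id) (ψ := fun q : (({t + 2} : Finset ℕ) → Vec n) =>
        q ⟨t + 2, Finset.mem_singleton_self _⟩) measurable_id (measurable_pi_apply _)
  have h2 : IndepFun (fun ω => (s₀ ω, s₁ ω))
      (fun ω => ((fun i : Finset.range (t + 1 + 1) => sourceFamily x₀ ξ i ω),
        sourceFamily x₀ ξ (t + 2) ω)) P :=
    h.indep_counter.comp (φ := id) (ψ := fun q : ℕ → Vec n =>
      ((fun i : Finset.range (t + 1 + 1) => q i), q (t + 2))) measurable_id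
      ((measurable_pi_lambda _ fun i => measurable_pi_apply _).prodMk (measurable_pi_apply _))
  have h3 := indepFun_prodMk_left (h.measurable_s₀.prodMk h.measurable_s₁)
    (measurable_pi_lambda _ fun i : Finset.range (t + 1 + 1) => hm i) (hm (t + 2)) h2 h1
  rw [IndepFun_iff_Indep] at h3
  exact h3

lemma measurable_source (h : NoiseAssumptions P ξ x₀ s₀ s₁) {t i : ℕ} (hi : i ≤ t + 1) :
    Measurable[h.historyFiltration t] (sourceFamily x₀ ξ i) :=
  ((measurable_pi_apply (⟨i, Finset.mem_range.2 (Nat.lt_succ_of_le hi)⟩ :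
    Finset.range (t + 1 + 1))).comp measurable_snd).comp
    (comap_measurable (history ξ x₀ s₀ s₁ (t + 1)))

lemma measurable_counters (h : NoiseAssumptions P ξ x₀ s₀ s₁) (t : ℕ) :
    Measurable[h.historyFiltration t] fun ω => (s₀ ω, s₁ ω) :=
  measurable_fst.comp (comap_measurable (history ξ x₀ s₀ s₁ (t + 1)))

end NoiseAssumptions

/-! ### Realizing the algorithm from time one as an adapted chain. -/

section Reconstruction

variable {n : ℕ} {Ω : Type*}

/-- The transition of the triple of estimate, measurement and counter under a noise `w`. -/
noncomputable def kestenStep (φ : Vec n → Vec n) (γ u : ℝ → ℝ) (z : Vec n × Vec n × ℝ) (w : Vec n) :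
    Vec n × Vec n × ℝ :=
  (z.1 - γ z.2.2 • (φ z.1 + w), φ z.1 + w, max (z.2.2 + u (-(inner ℝ (φ z.1 + w) z.2.1))) 0)

/-- The states of the algorithm from time one on, with the second initial counter replaced by
its positive part. -/
noncomputable def kestenState (φ : Vec n → Vec n) (γ u : ℝ → ℝ) (ξ : ℕ → Ω → Vec n) (x₀ : Ω → Vec n)
    (s₀ s₁ : Ω → ℝ) : ℕ → Ω → Vec n × Vec n × ℝ
  | 0, ω => (x₀ ω - γ (s₀ ω) • (φ (x₀ ω) + ξ 1 ω), φ (x₀ ω) + ξ 1 ω, max (s₁ ω) 0)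
  | t + 1, ω => kestenStep φ γ u (kestenState φ γ u ξ x₀ s₀ s₁ t ω) (ξ (t + 2) ω)

variable {φ : Vec n → Vec n} {γ u : ℝ → ℝ} {ξ x y : ℕ → Ω → Vec n} {s : ℕ → Ω → ℝ}

/-- All counters are nonnegative on such a path, so neither the extension of `γ` nor the positive
part of `s 1` has any effect. -/
lemma kestenState_eq (hp : IsKestenProcess φ γ u ξ x y s) {ω : Ω} (h₀ : 0 ≤ s 0 ω)
    (h₁ : 0 ≤ s 1 ω) (t : ℕ) :
    kestenState φ (fun r => γ (max r 0)) u ξ (x 0) (s 0) (s 1) t ω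
      = (x (t + 1) ω, y (t + 1) ω, s (t + 1) ω) := by
  have hs : ∀ t, 0 ≤ s (t + 1) ω := fun t => by
    cases t with
    | zero => exact h₁
    | succ t => rw [hp.counter (t + 1 + 1) (by omega)]; exact le_max_right _ _
  induction t with
  | zero =>
    have hy : y 1 ω = φ (x 0 ω) + ξ 1 ω := hp.measurement 1 le_rfl ω
    have hx : x 1 ω = x 0 ω - γ (s 0 ω) • y 1 ω := hp.estimate 1 le_rfl ω
    simp only [kestenState, zero_add, max_eq_left h₀, max_eq_left h₁, hx, hy]
  | succ t ih =>
    have hy : y (t + 2) ω = φ (x (t + 1) ω) + ξ (t + 2) ω :=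
      hp.measurement (t + 2) (by omega) ω
    have hx : x (t + 2) ω = x (t + 1) ω - γ (s (t + 1) ω) • y (t + 2) ω :=
      hp.estimate (t + 2) (by omega) ω
    have hs' : s (t + 2) ω = max (s (t + 1) ω + u (-(inner ℝ (y (t + 2) ω) (y (t + 1) ω)))) 0 :=
      hp.counter (t + 2) (by omega) ω
    simp only [kestenState, ih, kestenStep, max_eq_left (hs t), ← hy, ← hx, ← hs']

/-- The chain is rebuilt by recursion because its counter must be nonnegative at every sample point,
whereas the given `s 1` is so only almost surely. Starting at time one removes the special role of
`s 0`. -/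
lemma NoiseAssumptions.kestenChain [m : MeasurableSpace Ω] {P : Measure Ω}
    [IsProbabilityMeasure P] {x₀ : Ω → Vec n} {s₀ s₁ : Ω → ℝ}
    (h : NoiseAssumptions P ξ x₀ s₀ s₁) (hφ : Measurable φ) (hγ : Measurable γ)
    (hu : Measurable u) :
    KestenChain P h.historyFiltration (P.map (ξ 1)) φ γ u (fun t => ξ (t + 1))
      (fun t ω => (kestenState φ γ u ξ x₀ s₀ s₁ t ω).1)
      (fun t ω => (kestenState φ γ u ξ x₀ s₀ s₁ t ω).2.1)
      (fun t ω => (kestenState φ γ u ξ x₀ s₀ s₁ t ω).2.2) := by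
  have hξm : ∀ {t i : ℕ}, i + 1 ≤ t + 1 → Measurable[h.historyFiltration t] (ξ (i + 1)) :=
    fun hi => h.measurable_source hi
  have hx₀m : ∀ t, Measurable[h.historyFiltration t] x₀ :=
    fun t => h.measurable_source (Nat.zero_le (t + 1))
  have hstate : ∀ t, Measurable[h.historyFiltration t] (kestenState φ γ u ξ x₀ s₀ s₁ t) := by
    intro t
    induction t with
    | zero =>
      have h1 : Measurable fun q : (Vec n × Vec n) × ℝ × ℝ =>
          (q.1.1 - γ q.2.1 • (φ q.1.1 + q.1.2), φ q.1.1 + q.1.2, max q.2.2 0) := by fun_prop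
      exact h1.comp (((hx₀m 0).prodMk (hξm le_rfl)).prodMk (h.measurable_counters 0))
    | succ t ih =>
      have h1 : Measurable (Function.uncurry (kestenStep φ γ u)) := by
        unfold Function.uncurry kestenStep
        fun_prop
      exact h1.comp ((ih.mono (h.historyFiltration.mono (Nat.le_succ t)) le_rfl).prodMk
        (hξm le_rfl))
  exact
  { measurable_noise := fun t => h.measurable_noise _ (by omega)
    indep := h.indep_history
    law := fun t => (h.identDistrib (t + 2) (by omega)).map_eq
    measurable_x := fun t => measurable_fst.comp (hstate t)
    measurable_y := fun t => (measurable_fst.comp measurable_snd).comp (hstate t)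
    measurable_s := fun t => (measurable_snd.comp measurable_snd).comp (hstate t)
    y_succ := fun t ω => rfl
    x_succ := fun t ω => rfl
    s_succ := fun t ω => rfl
    s_nonneg := fun t ω => by cases t <;> exact le_max_right _ _ }

end Reconstruction

theorem theorem1 {n : ℕ} {Ω : Type*} [MeasurableSpace Ω] (P : Measure Ω) [IsProbabilityMeasure P]
    (φ : Vec n → Vec n) (xs : Vec n) (γ u : ℝ → ℝ)
    (V : Vec n → ℝ) (M : Matrix (Fin n) (Fin n) ℝ)
    (ξ x y : ℕ → Ω → Vec n) (s : ℕ → Ω → ℝ)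
    (hprocess : IsKestenProcess φ γ u ξ x y s)
    (hnoise : NoiseAssumptions P ξ (x 0) (s 0) (s 1))
    (hstep : StepAssumptions γ)
    (hlyapunov : LyapunovAssumptions φ xs (γ 0) (covMatrix P (ξ 1)) V M)
    (hsigmoid : SigmoidAssumptions P (ξ 1) (ξ 2) u) :
    ∀ᵐ ω ∂P, Tendsto (fun t => x t ω) atTop (𝓝 xs) := by
  -- In dimension zero the space is a point; otherwise it has the nonzero vectors needed for the
  -- alternating run.
  rcases Nat.eq_zero_or_pos n with rfl | hn
  · refine ae_of_all _ fun ω => ?_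
    rw [show (fun t => x t ω) = fun _ => xs from funext fun t => Subsingleton.elim _ _]
    exact tendsto_const_nhds
  have : NeZero n := ⟨hn.ne'⟩
  have hm₁ := hnoise.measurable_noise 1 le_rfl
  have hm₂ := hnoise.measurable_noise 2 one_le_two
  have : IsProbabilityMeasure (P.map (ξ 1)) := Measure.isProbabilityMeasure_map hm₁.aemeasurable
  obtain ⟨b, hu⟩ := hsigmoid.exists_isSigmoid
  obtain ⟨r, κ, hr, hκ0, hκ⟩ := hsigmoid.exists_le_integral_counterGain hm₁ hm₂ rfl
    (hnoise.identDistrib 2 one_le_two).map_eq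
    (by simpa [sourceFamily] using hnoise.indep.indepFun (i := 1) (j := 2) (by norm_num))
  have hγ := hstep.isStepFunction
  have hl : LyapunovAssumptions φ xs ((fun r => γ (max r 0)) 0)
      (covMatrix (P.map (ξ 1)) id) V M := by
    rw [hnoise.covMatrix_map]
    simpa using hlyapunov
  have hchain := hnoise.kestenChain hlyapunov.continuous_field.measurable hγ.measurable
    hu.measurable
  filter_upwards [hchain.ae_tendsto hγ hnoise.isNoiseLaw hu hl hr hκ0 hκ, hnoise.nonneg_s₀,
    hnoise.nonneg_s₁] with ω hω h₀ h₁
  simp only [kestenState_eq hprocess h₀ h₁] at hω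
  exact (tendsto_add_atTop_iff_nat 1).1 hω
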